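/- Let $q\ge 2$ be an integer, let $\mathfrak X$ be the homogeneous tree of degree $q+1$ (every vertex has $q+1$ neighbours) with graph distance $d$ and counting measure, fix a vertex $o$ and put $|x|=d(o,x)$. Let $\Omega$ be the set of infinite geodesic rays $\omega=(\omega_0,\omega_1,\dots)$ with $\omega_0=o$, with the $\sigma$-algebra generated by the sets $E(x)=\{\omega:\ x\in\omega\}$, and let $\nu$ be the unique probability measure on $\Omega$ with $\nu(E(x))=\frac{q}{(q+1)q^{|x|}}$ for $x\ne o$. Put $h_\omega(x)=\lim_{m\to\infty}(m-d(x,\omega_m))$, $\tau=\pi/\log q$, $c(z)=\frac{q^{1/2}}{q+1}\,\frac{q^{1/2+iz}-q^{-1/2-iz}}{q^{iz}-q^{-iz}}$, and let $d\mu(s)=\frac{q\log q}{2\pi(q+1)}|c(s)|^{-2}ds$ on $[0,\tau]$. For finitely supported $f$ on $\mathfrak X$ let $\mathcal Hf(\omega,s)=\sum_y f(y)q^{(1/2+is)h_\omega(y)}$, and denote by $\mathcal H$ also its continuous extension to an isometry $L^2(\mathfrak X)\to L^2(\Omega\times[0,\tau],\nu\times\mu)$. A bounded operator $T:L^{p}(\mathfrak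 X)\to L^{r}(\mathfrak X)$ *has symbol* $\sigma:\mathfrak X\times\Omega\times[0,\tau]\to\mathbb C$, written $T=T_\sigma$, if for every finitely supported $u$ and every $x\in\mathfrak X$ $$Tu(x)=\int_\Omega\int_0^\tau q^{(\frac12-is)h_\omega(x)}\sigma(x,\omega,s)\,\mathcal Hu(\omega,s)\,d\nu(\omega)\,d\mu(s),$$ the integral being absolutely convergent. A bounded operator $T:X\to Y$ of Banach spaces is *nuclear* if there are $x_k'\in X'$, $y_k\in Y$ with $\sum_k\|x_k'\|\|y_k\|<\infty$ and $Tx=\sum_k x_k'(x)y_k$ for all $x\in X$. Conjugate exponents are denoted by $p'$. **Theorem.** Let $1\le p_1,p_2<\infty$, let $\sigma$ be measurable and let $T_\sigma:L^{p_1}(\mathfrak X)\to L^{p_2}(\mathfrak X)$ be nuclear. Then the adjoint of $T_\sigma$, that is, the bounded operator $T_\sigma^*:L^{p_2'}(\mathfrak X)\to L^{p_1'}(\mathfrak X)$ determined by $\sum_x T_\sigma u(x)\overline{v(x)}=\sum_x u(x)\overline{T_\sigma^*v(x)}$ for $u\in L^{p_1}(\mathfrak X)$, $v\in L^{p_2'}(\mathfrak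 X)$, exists, is unique and is nuclear. Moreover, there are sequences $(g_k)$ in $L^{p_1'}(\mathfrak X)$ and $(f_k)$ in $L^{p_2}(\mathfrak X)$ with $\sum_k\|g_k\|_{p_1'}\|f_k\|_{p_2}<\infty$ and $$\text{(a)}\quad T_\sigma u=\sum_k\Big(\sum_y g_k(y)u(y)\Big)f_k\quad\text{for all }u\in L^{p_1}(\mathfrak X),$$ and, if $p_1\ge 2$, also, for every $x$ and almost every $(\omega,s)$, $$\text{(b)}\quad \sigma(x,\omega,s)=q^{-(\frac12-is)h_\omega(x)}\sum_k f_k(x)\,\overline{\mathcal H\overline{g_k}(\omega,s)} .$$ Finally, let $(g_k)\subset L^{p_1'}(\mathfrak X)$, $(f_k)\subset L^{p_2}(\mathfrak X)$ be any sequences with $\sum_k\|g_k\|_{p_1'}\|f_k\|_{p_2}<\infty$ such that (a) holds, or such that (b) holds and either $p_1\ge2$, or all $g_k\in L^2(\mathfrak X)$ and $\sum_k|f_k(x)|\,\|g_k\|_2<\infty$ for every $x$. Assume that either $p_2\le 2$, or all $f_k\in L^2(\mathfrak X)$ and $\sum_k|g_k(x)|\,\|f_k\|_2<\infty$ for every $x$.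 Then for every $x$ the series in $$\sigma^*(x,\omega,s)=q^{-(\frac12-is)h_\omega(x)}\sum_k\overline{\mathcal Hf_k(\omega,s)}\;\overline{g_k(x)}$$ converges absolutely for almost every $(\omega,s)$, and $T_\sigma^*$ has symbol $\sigma^*$. -/

import Mathlib

open MeasureTheory Filter Topology
open scoped ENNReal

namespace HomTree

variable {V : Type*}

/-- The boundary of the tree: infinite geodesic rays starting at `o`. -/
def Boundary (G : SimpleGraph V) (o : V) : Type _ :=
  {w : ℕ → V // w 0 = o ∧ (∀ n, G.Adj (w n) (w (n + 1))) ∧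
    ∀ m n, m ≤ n → G.dist (w m) (w n) = n - m}

/-- The set `E(x)` of boundary points whose ray passes through `x`. -/
def cyl (G : SimpleGraph V) (o x : V) : Set (Boundary G o) := {w | ∃ n, w.1 n = x}

/-- The `σ`-algebra generated by the sets `E(x)`. -/
instance instMeasurableSpaceBoundary (G : SimpleGraph V) (o : V) :
    MeasurableSpace (Boundary G o) :=
  MeasurableSpace.generateFrom (Set.range (cyl G o))

/-- The defining property of the measure `ν` -/
def IsBoundaryMeasure (G : SimpleGraph V) (q : ℕ) (o : V) (ν : Measure (Boundary G o)) : Prop :=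
  IsProbabilityMeasure ν ∧
    ∀ x, x ≠ o → ν (cyl G o x) = (q : ℝ≥0∞) / ((q + 1) * (q : ℝ≥0∞) ^ G.dist o x)

theorem mem_cyl_iff {G : SimpleGraph V} {o x : V} (w : Boundary G o) :
    w ∈ cyl G o x ↔ w.1 (G.dist o x) = x := by
  constructor
  · rintro ⟨n, rfl⟩
    have h := w.2.2.2 0 n (Nat.zero_le _)
    rw [w.2.1] at h
    rw [h, Nat.sub_zero]
  · intro h
    exact ⟨_, h⟩

/-- The neighbours of `x` that are further away from `o`. -/
def children (G : SimpleGraph V) (o x : V) : Set V :=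
  {y | G.Adj x y ∧ G.dist o y = G.dist o x + 1}

theorem parent_unique {G : SimpleGraph V} (hG : G.IsTree) {o x y z : V}
    (hy : x ∈ children G o y) (hz : x ∈ children G o z) : y = z := by
  have key : ∀ u, x ∈ children G o u → ∃ p : G.Walk o x, p.IsPath ∧ p.penultimate = u := by
    intro u hu
    obtain ⟨p, hp⟩ := hG.connected.exists_walk_length_eq_dist o u
    refine ⟨p.concat hu.1, ?_, by simp⟩
    apply SimpleGraph.Walk.isPath_of_length_eq_dist
    rw [SimpleGraph.Walk.length_concat, hp, hu.2]
  obtain ⟨p, hp, rfl⟩ := key y hy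
  obtain ⟨r, hr, rfl⟩ := key z hz
  have := (hG.isAcyclic.subsingleton_path o x).elim ⟨p, hp⟩ ⟨r, hr⟩
  simp only [Subtype.mk.injEq] at this
  rw [this]

theorem exists_parent {G : SimpleGraph V} (hG : G.IsTree) {o x : V} (hx : x ≠ o) :
    ∃ y, x ∈ children G o y := by
  obtain ⟨p, hp⟩ := hG.connected.exists_walk_length_eq_dist o x
  have hn : ¬ p.Nil := fun h => hx h.eq.symm
  have hadj := p.adj_penultimate hn
  refine ⟨p.penultimate, hadj, ?_⟩
  have h1 : G.dist o p.penultimate ≤ p.dropLast.length := SimpleGraph.dist_le _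
  have h2 : p.dropLast.length + 1 = p.length := by
    rw [← SimpleGraph.Walk.length_concat (p := p.dropLast) (h := hadj), SimpleGraph.Walk.concat_dropLast]
  have h3 := hG.dist_eq_dist_add_one_of_adj o hadj
  omega

theorem ncard_children {G : SimpleGraph V} [G.LocallyFinite] {q : ℕ} (hG : G.IsTree)
    (hreg : G.IsRegularOfDegree (q + 1)) (o x : V) [Decidable (x = o)] :
    (children G o x).Finite ∧ (children G o x).ncard = if x = o then q + 1 else q := by
  have hsub : children G o x ⊆ G.neighborSet x := fun y hy => hy.1
  have hfin : (G.neighborSet x).Finite := Set.toFinite _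
  have hcard : (G.neighborSet x).ncard = q + 1 := by
    rw [← hreg x, Set.ncard_eq_toFinset_card', SimpleGraph.degree, SimpleGraph.neighborFinset]
  refine ⟨hfin.subset hsub, ?_⟩
  split_ifs with hx
  · subst hx
    rw [← hcard]
    congr 1
    refine Set.Subset.antisymm hsub fun y hy => ⟨hy, ?_⟩
    rw [SimpleGraph.dist_eq_one_iff_adj.2 hy, SimpleGraph.dist_self]
  · obtain ⟨y, hy⟩ := exists_parent hG hx
    have : G.neighborSet x = insert y (children G o x) := by
      ext z
      simp only [SimpleGraph.mem_neighborSet, Set.mem_insert_iff]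
      constructor
      · intro hz
        rcases hG.dist_eq_dist_add_one_of_adj o hz with h | h
        · exact Or.inl (parent_unique hG ⟨hz.symm, h⟩ hy)
        · exact Or.inr ⟨hz, h⟩
      · rintro (rfl | h)
        · exact hy.1.symm
        · exact h.1
    have hny : y ∉ children G o x := fun h => by
      have := h.2
      have := hy.2
      omega
    rw [this, Set.ncard_insert_of_notMem hny (hfin.subset hsub)] at hcard
    omega

/-- The ray that starts at `o` and at every vertex moves on to the child prescribed by `c`. -/
def follow (G : SimpleGraph V) (o : V) (c : ∀ v, children G o v) : ℕ → V
  | 0 => o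
  | n + 1 => c (follow G o c n)

theorem dist_follow {G : SimpleGraph V} {o : V} (c : ∀ v, children G o v) (n : ℕ) :
    G.dist o (follow G o c n) = n := by
  induction n with
  | zero => simp [follow]
  | succ n ih =>
    have := (c (follow G o c n)).2.2
    rw [ih] at this
    exact this

theorem follow_geodesic {G : SimpleGraph V} (hG : G.IsTree) {o : V}
    (c : ∀ v, children G o v) : follow G o c 0 = o ∧
      (∀ n, G.Adj (follow G o c n) (follow G o c (n + 1))) ∧
      ∀ m n, m ≤ n → G.dist (follow G o c m) (follow G o c n) = n - m := by
  have hadj : ∀ n, G.Adj (follow G o c n) (follow G o c (n + 1)) := fun n => (c _).2.1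
  refine ⟨rfl, hadj, fun m n hmn => ?_⟩
  have h1 : G.dist (follow G o c m) (follow G o c n) ≤ n - m := by
    induction n, hmn using Nat.le_induction with
    | base => simp
    | succ n hmn ih =>
      have := hG.connected.dist_triangle (u := follow G o c m) (v := follow G o c n)
        (w := follow G o c (n + 1))
      rw [SimpleGraph.dist_eq_one_iff_adj.2 (hadj n)] at this
      omega
  have h2 := hG.connected.dist_triangle (u := o) (v := follow G o c m) (w := follow G o c n)
  rw [dist_follow, dist_follow] at h2
  omega

/-- At the level of the choices, `E(x)` is a box in finitely many coordinates. -/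
theorem follow_box {G : SimpleGraph V} [G.LocallyFinite] {q : ℕ} (hq : 2 ≤ q) (hG : G.IsTree)
    (hreg : G.IsRegularOfDegree (q + 1)) (o : V)
    (μ : ∀ v, @Measure (children G o v) ⊤)
    (hμ : ∀ v a, μ v {a} = ((children G o v).ncard : ℝ≥0∞)⁻¹) (n : ℕ) :
    ∀ x, G.dist o x = n → ∃ (s : Finset V) (t : ∀ v, Set (children G o v)),
      (∀ v ∈ s, G.dist o v < n) ∧ {c | follow G o c n = x} = Set.pi s t ∧
      ∏ v ∈ s, μ v (t v) =
        if n = 0 then 1 else (q : ℝ≥0∞) / ((q + 1) * (q : ℝ≥0∞) ^ n) := by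
  classical
  have hq0 : (q : ℝ≥0∞) ≠ 0 := by
    have : q ≠ 0 := by omega
    exact_mod_cast this
  have hqt : (q : ℝ≥0∞) ≠ ⊤ := ENNReal.natCast_ne_top q
  induction n with
  | zero =>
    intro x hx
    have hx : o = x := (hG.connected.dist_eq_zero_iff).1 hx
    exact ⟨∅, fun _ => Set.univ, by simp, by simp [follow, hx], by simp⟩
  | succ n ih =>
    intro x hx
    have hxo : x ≠ o := by
      rintro rfl
      simp at hx
    obtain ⟨y, hy⟩ := exists_parent hG hxo
    have hyn : G.dist o y = n := by
      have := hy.2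
      omega
    obtain ⟨s, t, hs, hst, hprod⟩ := ih y hyn
    have hys : y ∉ s := fun h => by
      have := hs y h
      omega
    refine ⟨insert y s, Function.update t y {⟨x, hy⟩}, ?_, ?_, ?_⟩
    · intro v hv
      rcases Finset.mem_insert.1 hv with rfl | hv
      · omega
      · exact (hs v hv).trans (Nat.lt_succ_self n)
    · have hbox : Set.pi (↑(insert y s)) (Function.update t y {⟨x, hy⟩}) =
          Set.pi s t ∩ {c | c y = ⟨x, hy⟩} := by
        ext c
        simp only [Finset.coe_insert, Set.insert_pi, Function.update_self, Set.mem_inter_iff,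
          Set.mem_preimage, Set.mem_singleton_iff, Set.mem_ofPred_eq, Set.mem_pi]
        constructor
        · rintro ⟨h1, h2⟩
          refine ⟨fun i hi => ?_, h1⟩
          have := h2 i hi
          rwa [Function.update_of_ne (by rintro rfl; exact hys hi)] at this
        · rintro ⟨h1, h2⟩
          refine ⟨h2, fun i hi => ?_⟩
          rw [Function.update_of_ne (by rintro rfl; exact hys hi)]
          exact h1 i hi
      rw [hbox, ← hst]
      ext c
      simp only [Set.mem_ofPred_eq, Set.mem_inter_iff, follow]
      constructor
      · intro h
        have h1 : follow G o c n = y := by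
          refine parent_unique hG (x := x) ?_ hy
          have := (c (follow G o c n)).2
          rwa [h] at this
        refine ⟨h1, ?_⟩
        rw [h1] at h
        exact Subtype.ext h
      · rintro ⟨h1, h2⟩
        rw [h1, h2]
    · rw [Finset.prod_insert hys, Function.update_self, hμ, (ncard_children hG hreg o y).2]
      have : ∏ v ∈ s, μ v (Function.update t y {⟨x, hy⟩} v) = ∏ v ∈ s, μ v (t v) := by
        refine Finset.prod_congr rfl fun v hv => ?_
        rw [Function.update_of_ne (by rintro rfl; exact hys hv)]
      rw [this, hprod, if_neg (Nat.succ_ne_zero n)]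
      by_cases hn : n = 0
      · subst hn
        have : y = o := ((hG.connected.dist_eq_zero_iff).1 hyn).symm
        rw [if_pos this, if_pos rfl, mul_one, zero_add, pow_one, ENNReal.div_eq_inv_mul,
          ENNReal.mul_inv (Or.inr hqt) (Or.inr hq0), mul_assoc, ENNReal.inv_mul_cancel hq0 hqt,
          mul_one]
        push_cast
        rfl
      · have : y ≠ o := by
          rintro rfl
          simp at hyn
          exact hn hyn.symm
        rw [if_neg this, if_neg hn, pow_succ, ← mul_assoc, ENNReal.div_eq_inv_mul,
          ENNReal.div_eq_inv_mul,
          ENNReal.mul_inv (a := (↑q + 1) * ↑q ^ n) (Or.inr hqt) (Or.inr hq0)]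
        ring

/-- The measure `ν` exists: it is the law of the ray that at every vertex moves on to a child
chosen uniformly and independently. -/
theorem exists_isBoundaryMeasure {G : SimpleGraph V} [G.LocallyFinite] {q : ℕ} (hq : 2 ≤ q)
    (hG : G.IsTree) (hreg : G.IsRegularOfDegree (q + 1)) (o : V) :
    ∃ ν, IsBoundaryMeasure G q o ν := by
  classical
  have hne : ∀ v, Nonempty (children G o v) := fun v => by
    have h := ncard_children hG hreg o v
    have : (children G o v).ncard ≠ 0 := by
      rw [h.2]
      split_ifs <;> omega
    exact (Set.nonempty_of_ncard_ne_zero this).to_subtype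
  let hft : ∀ v, Fintype (children G o v) := fun v => (ncard_children hG hreg o v).1.fintype
  let ms : ∀ v, MeasurableSpace (children G o v) := fun v => ⊤
  let μ : ∀ v, Measure (children G o v) := fun v => (PMF.uniformOfFintype (children G o v)).toMeasure
  have hμ : ∀ v a, μ v {a} = ((children G o v).ncard : ℝ≥0∞)⁻¹ := fun v a => by
    simp only [μ]
    rw [PMF.toMeasure_apply_singleton _ _ (MeasurableSet.singleton a),
      PMF.uniformOfFintype_apply, Set.ncard_eq_toFinset_card', Set.toFinset_card]
  let F : (∀ v, children G o v) → Boundary G o := fun c => ⟨follow G o c, follow_geodesic hG c⟩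
  have hpre : ∀ x, F ⁻¹' (cyl G o x) = {c | follow G o c (G.dist o x) = x} := fun x => by
    ext c
    simp only [Set.mem_preimage, mem_cyl_iff]
    rfl
  have hF : Measurable F := by
    refine measurable_generateFrom ?_
    rintro _ ⟨x, rfl⟩
    obtain ⟨s, t, -, hst, -⟩ := follow_box hq hG hreg o μ hμ _ x rfl
    rw [hpre, hst]
    exact MeasurableSet.pi s.countable_toSet fun _ _ => trivial
  refine ⟨(Measure.infinitePi μ).map F, Measure.isProbabilityMeasure_map hF.aemeasurable, ?_⟩
  intro x hx
  obtain ⟨s, t, -, hst, hprod⟩ := follow_box hq hG hreg o μ hμ _ x rfl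
  rw [Measure.map_apply hF (MeasurableSpace.measurableSet_generateFrom ⟨x, rfl⟩), hpre, hst,
    Measure.infinitePi_pi μ (fun _ _ => trivial), hprod, if_neg]
  intro h
  exact hx ((hG.connected.dist_eq_zero_iff).1 h).symm

theorem mem_children_ray {G : SimpleGraph V} {o : V} (w : Boundary G o) (n : ℕ) :
    w.1 (n + 1) ∈ children G o (w.1 n) := by
  have h : ∀ m, G.dist o (w.1 m) = m := fun m => by
    have := w.2.2.2 0 m (Nat.zero_le _)
    rwa [w.2.1, Nat.sub_zero] at this
  exact ⟨w.2.2.1 n, by rw [h, h]⟩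

/-- The measure `ν` is unique. -/
theorem IsBoundaryMeasure.unique {G : SimpleGraph V} {q : ℕ} {o : V} (hG : G.IsTree)
    {ν ν' : Measure (Boundary G o)} (h : IsBoundaryMeasure G q o ν)
    (h' : IsBoundaryMeasure G q o ν') : ν = ν' := by
  have := h.1
  have := h'.1
  have hback : ∀ (w w' : Boundary G o) (n : ℕ), w.1 n = w'.1 n → ∀ m ≤ n, w.1 m = w'.1 m := by
    intro w w' n
    induction n with
    | zero =>
      intro h0 m hm
      rwa [Nat.le_zero.1 hm]
    | succ n ih =>
      intro h0 m hm
      rcases Nat.lt_or_ge n m with hnm | hnm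
      · have : m = n + 1 := by omega
        rwa [this]
      · refine ih (parent_unique hG (mem_children_ray w n) ?_) m hnm
        rw [h0]
        exact mem_children_ray w' n
  have hpi : IsPiSystem (Set.range (cyl G o)) := by
    have key : ∀ x y, G.dist o x ≤ G.dist o y → (cyl G o x ∩ cyl G o y).Nonempty →
        cyl G o y ⊆ cyl G o x := by
      rintro x y hxy ⟨w, h1, h2⟩ w' h3
      rw [mem_cyl_iff] at h1 h2 h3 ⊢
      rw [hback w' w _ (h3.trans h2.symm) _ hxy, h1]
    rintro _ ⟨x, rfl⟩ _ ⟨y, rfl⟩ hxy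
    rcases le_total (G.dist o x) (G.dist o y) with hle | hle
    · rw [Set.inter_eq_right.2 (key x y hle hxy)]
      exact ⟨y, rfl⟩
    · rw [Set.inter_comm] at hxy
      rw [Set.inter_eq_left.2 (key y x hle hxy)]
      exact ⟨x, rfl⟩
  refine ext_of_generate_finite _ rfl hpi ?_ (by simp)
  rintro _ ⟨x, rfl⟩
  by_cases hx : x = o
  · have : cyl G o x = Set.univ := Set.eq_univ_of_forall fun w => ⟨0, by rw [w.2.1, hx]⟩
    rw [this, measure_univ, measure_univ]
  · rw [h.2 x hx, h'.2 x hx]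

open Classical in
/-- The measure `ν` on the boundary of the homogeneous tree of degree `q + 1`. For such a tree the
first case occurs, by `exists_isBoundaryMeasure`, and determines the measure, by
`IsBoundaryMeasure.unique`. -/
noncomputable def boundaryMeasure (G : SimpleGraph V) (q : ℕ) (o : V) : Measure (Boundary G o) :=
  if h : ∃ ν, IsBoundaryMeasure G q o ν then h.choose else 0

theorem isBoundaryMeasure_boundaryMeasure {G : SimpleGraph V} [G.LocallyFinite] {q : ℕ}
    (hq : 2 ≤ q) (hG : G.IsTree) (hreg : G.IsRegularOfDegree (q + 1)) (o : V) :
    IsBoundaryMeasure G q o (boundaryMeasure G q o) := by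
  have h := exists_isBoundaryMeasure hq hG hreg o
  rw [boundaryMeasure, dif_pos h]
  exact h.choose_spec

/-- The height `h_ω(x) = lim_m (m - d(x, ω_m))`; the sequence is eventually constant. -/
noncomputable def height (G : SimpleGraph V) (o : V) (w : Boundary G o) (x : V) : ℤ :=
  limUnder atTop fun m : ℕ => (m : ℤ) - (G.dist x (w.1 m) : ℤ)

/-- The function `c(z)`. -/
noncomputable def cFun (q : ℕ) (z : ℂ) : ℂ :=
  (q : ℂ) ^ (1 / 2 : ℂ) / (q + 1) *
    (((q : ℂ) ^ (1 / 2 + Complex.I * z) - (q : ℂ) ^ (-(1 / 2) - Complex.I * z)) /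
      ((q : ℂ) ^ (Complex.I * z) - (q : ℂ) ^ (-(Complex.I * z))))

/-- The Plancherel measure `dμ(s) = c_P |c(s)|⁻² ds` on `[0, τ]`, `τ = π / log q`, regarded as a
measure on `ℝ` that is carried by `[0, τ]`. It is a probability measure. -/
noncomputable def plancherel (q : ℕ) : Measure ℝ :=
  (volume.restrict (Set.Icc 0 (Real.pi / Real.log q))).withDensity fun s =>
    ENNReal.ofReal (q * Real.log q / (2 * Real.pi * (q + 1)) * (‖cFun q s‖ ^ 2)⁻¹)

/-- The measure `ν × μ` on `Ω × [0, τ]`. -/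
noncomputable def dualMeasure (G : SimpleGraph V) (q : ℕ) (o : V) : Measure (Boundary G o × ℝ) :=
  (boundaryMeasure G q o).prod (plancherel q)

/-- `q ^ ((1/2 + i s) h_ω(x))`. -/
noncomputable def wave (G : SimpleGraph V) (q : ℕ) (o : V) (x : V) (z : Boundary G o × ℝ) : ℂ :=
  (q : ℂ) ^ ((1 / 2 + Complex.I * z.2) * (height G o z.1 x : ℂ))

/-- `q ^ ((1/2 - i s) h_ω(x))`. -/
noncomputable def waveBar (G : SimpleGraph V) (q : ℕ) (o : V) (x : V) (z : Boundary G o × ℝ) : ℂ :=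
  (q : ℂ) ^ ((1 / 2 - Complex.I * z.2) * (height G o z.1 x : ℂ))

/-- `F` is the limit in `L²(Ω × [0, τ])` of the transforms of the finite truncations of `f`. -/
def IsL2Transform (G : SimpleGraph V) (q : ℕ) (o : V) (f : V → ℂ)
    (F : Boundary G o × ℝ → ℂ) : Prop :=
  MemLp F 2 (dualMeasure G q o) ∧
    Tendsto (fun A : Finset V =>
      eLpNorm (fun z => F z - ∑ y ∈ A, f y * wave G q o y z) 2 (dualMeasure G q o)) atTop (𝓝 0)

open Classical in
/-- The Fourier-Helgason transform: the finite sum `∑_y f(y) q ^ ((1/2 + i s) h_ω(y))` if `f` has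
finite support, and otherwise (a representative of) the value at `f` of its continuous extension
to `L²(X)`. -/
noncomputable def transform (G : SimpleGraph V) (q : ℕ) (o : V) (f : V → ℂ) :
    Boundary G o × ℝ → ℂ :=
  if f.support.Finite then fun z => ∑ᶠ y, f y * wave G q o y z
  else if h : ∃ F, IsL2Transform G q o f F then h.choose else 0

/-- The bounded operator `T : L^p(X) → L^r(X)` is the pseudo-differential operator with symbol `σ`:
on finitely supported functions it is given by the (absolutely convergent) integral of
`q ^ ((1/2 - i s) h_ω(x)) σ(x, ω, s) 𝓗u(ω, s)` over `Ω × [0, τ]`. -/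
def HasSymbol (G : SimpleGraph V) (q : ℕ) (o : V) {p r : ℝ≥0∞} [Fact (1 ≤ p)] [Fact (1 ≤ r)]
    (T : lp (fun _ : V => ℂ) p →L[ℂ] lp (fun _ : V => ℂ) r)
    (σ : V → Boundary G o × ℝ → ℂ) : Prop :=
  ∀ u : lp (fun _ : V => ℂ) p, (Function.support (u : V → ℂ)).Finite → ∀ x,
    Integrable (fun z => waveBar G q o x z * σ x z * transform G q o u z) (dualMeasure G q o) ∧
    T u x = ∫ z, waveBar G q o x z * σ x z * transform G q o u z ∂(dualMeasure G q o)

/-- Nuclear operators between Banach spaces. -/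
def IsNuclear {E F : Type*} [NormedAddCommGroup E] [NormedSpace ℂ E] [NormedAddCommGroup F]
    [NormedSpace ℂ F] (T : E →L[ℂ] F) : Prop :=
  ∃ (φ : ℕ → StrongDual ℂ E) (y : ℕ → F), Summable (fun k => ‖φ k‖ * ‖y k‖) ∧
    ∀ u, HasSum (fun k => φ k u • y k) (T u)

/-- `S : L^{r'}(X) → L^{p'}(X)` is the adjoint of `T : L^p(X) → L^r(X)` with respect to the pairing
`∑_x f(x) conj (g(x))`. -/
def IsAdjoint {p r p' r' : ℝ≥0∞} [Fact (1 ≤ p)] [Fact (1 ≤ r)] [Fact (1 ≤ p')] [Fact (1 ≤ r')]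
    (T : lp (fun _ : V => ℂ) p →L[ℂ] lp (fun _ : V => ℂ) r)
    (S : lp (fun _ : V => ℂ) r' →L[ℂ] lp (fun _ : V => ℂ) p') : Prop :=
  ∀ (u : lp (fun _ : V => ℂ) p) (v : lp (fun _ : V => ℂ) r'),
    ∑' x, T u x * starRingEnd ℂ (v x) = ∑' x, u x * starRingEnd ℂ (S v x)

/-- `∑_k ‖g_k‖ ‖f_k‖ < ∞` and `T u = ∑_k (∑_y g_k(y) u(y)) f_k`, i.e. `∑_k f_k(x) g_k(y)` is the
kernel of `T`. -/
def IsNuclearDecomposition {p r p' : ℝ≥0∞} [Fact (1 ≤ p)] [Fact (1 ≤ r)] [Fact (1 ≤ p')]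
    (T : lp (fun _ : V => ℂ) p →L[ℂ] lp (fun _ : V => ℂ) r)
    (g : ℕ → lp (fun _ : V => ℂ) p') (f : ℕ → lp (fun _ : V => ℂ) r) : Prop :=
  Summable (fun k => ‖g k‖ * ‖f k‖) ∧ ∀ u, HasSum (fun k => (∑' y, g k y * u y) • f k) (T u)

/-- `∑_k ‖g_k‖ ‖f_k‖ < ∞` and
`σ(x, ω, s) = q ^ (-(1/2 - i s) h_ω(x)) ∑_k f_k(x) conj (𝓗(conj g_k)(ω, s))` for all `x` and
almost all `(ω, s)`. -/
def IsSymbolDecomposition (G : SimpleGraph V) (q : ℕ) (o : V) {r p' : ℝ≥0∞} [Fact (1 ≤ r)]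
    [Fact (1 ≤ p')] (σ : V → Boundary G o × ℝ → ℂ)
    (g : ℕ → lp (fun _ : V => ℂ) p') (f : ℕ → lp (fun _ : V => ℂ) r) : Prop :=
  Summable (fun k => ‖g k‖ * ‖f k‖) ∧ ∀ x, ∀ᵐ z ∂(dualMeasure G q o),
    HasSum (fun k => (waveBar G q o x z)⁻¹ *
      (f k x * starRingEnd ℂ (transform G q o (fun y => starRingEnd ℂ (g k y)) z))) (σ x z)

/-- The transforms `𝓗a_k` make sense, and for every `x` the series `∑_k b_k(x) 𝓗a_k` converges
absolutely in `L²(Ω × [0, τ])`. -/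
def TransformSummable {p r : ℝ≥0∞} [Fact (1 ≤ p)] [Fact (1 ≤ r)]
    (a : ℕ → lp (fun _ : V => ℂ) p) (b : ℕ → lp (fun _ : V => ℂ) r) : Prop :=
  (∀ k, Memℓp (a k : V → ℂ) 2) ∧
    ∀ x, Summable fun k => ‖b k x‖ * Real.sqrt (∑' y, ‖a k y‖ ^ 2)

/-- `σ*(x, ω, s) = q ^ (-(1/2 - i s) h_ω(x)) ∑_k conj (𝓗f_k(ω, s)) conj (g_k(x))`. -/
noncomputable def adjointSymbol (G : SimpleGraph V) (q : ℕ) (o : V) {r p' : ℝ≥0∞}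
    (g : ℕ → lp (fun _ : V => ℂ) p') (f : ℕ → lp (fun _ : V => ℂ) r) (x : V)
    (z : Boundary G o × ℝ) : ℂ :=
  (waveBar G q o x z)⁻¹ *
    ∑' k, starRingEnd ℂ (transform G q o (f k) z) * starRingEnd ℂ (g k x)

end HomTree

/-! ### Geometry of the tree: parents, rays and heights. -/

namespace HomTree

variable {V : Type*} {G : SimpleGraph V} {o : V}

/-! Write `φ_y(ω,s) = q^((1/2+is)h_ω(y))` for the wave at `y`. The transform of `δ_y` is `φ_y`, so
having symbol `σ` says that for each `x` the numbers `Tδ_y(x)` are the integrals of `F_x = conj(φ_x)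
σ(x,·)` against the waves. Two facts about waves carry the proof.

They are orthonormal in `L²(ν × μ)` (`integral_wave_mul_conj`). The integral over `Ω` of `φ_x
conj(φ_y)` satisfies a first order recursion in `d = d(x,y)`, with solution `q^(-d/2) (c(w) w^d +
c(w⁻¹) w^(-d))`, `w = q^(is)`. Divided by `|c|² = c(w) c(w⁻¹)`, the bracket is a holomorphic
function on the closed disc plus its reflection, so the mean value property evaluates the integral
over `s`. Hence the transform is an isometry.

They separate `L¹(ν × μ)` (`ae_eq_zero_of_integral_wave`), which is stronger than completeness in
`L²` and is needed because `F_x` is only known to be integrable. Waves are eigenfunctions of the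
adjacency operator with eigenvalue `2√q cos(s log q)`, so all cosine moments vanish and Weierstrass
approximation isolates almost every frequency `s`. At a fixed `s`, comparing the waves of a vertex
and its parent gives the integral over the cylinder of that vertex.

By duality of `ℓ^p`, `p < ∞`, a nuclear `T` has kernel `∑_k f_k(x) g_k(y)`. When `g_k ∈ ℓ²`,
Parseval says that `conj(𝓗(conj g_k))` integrates against `φ_y` to `g_k(y)`; so (a) gives (b) by
separation, and (b) gives the kernel back by integration. The adjoint has kernel `∑_k conj(f_k(y))
conj(g_k(x))`, and the same superposition of transforms, with `f` and `g` exchanged, produces `σ*`.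
The exponent conditions `p₁ ≥ 2` and `p₂ ≤ 2` only serve to put `g_k`, respectively `f_k`, into `ℓ²`
with summable norms. -/

theorem dist_ray (w : Boundary G o) (n : ℕ) : G.dist o (w.1 n) = n := by
  have := w.2.2.2 0 n (Nat.zero_le _)
  rwa [w.2.1, Nat.sub_zero] at this

theorem adj_iff_children (hG : G.IsTree) (a : V) {x y : V} (h : G.Adj x y) :
    y ∈ children G a x ∨ x ∈ children G a y := by
  rcases hG.dist_eq_dist_add_one_of_adj a h with h' | h'
  · exact Or.inr ⟨h.symm, h'⟩
  · exact Or.inl ⟨h, h'⟩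

/-- An edge on which the two distance orders from adjacent points disagree is the edge between
these points. -/
theorem eq_of_children_of_children (hG : G.IsTree) {a b x y : V} (hab : G.Adj a b)
    (ha : y ∈ children G a x) (hb : x ∈ children G b y) : a = x ∧ b = y := by
  have hxy := ha.1
  have h1 := ha.2
  have h2 := hb.2
  have hx := hG.dist_eq_dist_add_one_of_adj x hab
  have hy := hG.dist_eq_dist_add_one_of_adj y hab
  rw [G.dist_comm (u := x), G.dist_comm (u := x)] at hx
  rw [G.dist_comm (u := y), G.dist_comm (u := y)] at hy
  have hby : G.dist b y = G.dist a x := by omega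
  by_cases h0 : y = b
  · subst h0
    rw [SimpleGraph.dist_self] at hby
    exact ⟨hG.connected.dist_eq_zero_iff.1 hby.symm, rfl⟩
  · exfalso
    -- The neighbour `u` of `y` towards `b` is also its neighbour towards `a`, so it is `x`; but `x`
    -- is further from `b` than `y` is.
    obtain ⟨u, hu⟩ := exists_parent hG h0
    have h3 := hu.2
    have h4 := hG.connected.dist_triangle (u := a) (v := b) (w := u)
    rw [SimpleGraph.dist_eq_one_iff_adj.2 hab] at h4
    have h5 := hG.dist_eq_dist_add_one_of_adj a hu.1
    have : u = x := parent_unique (o := a) hG ⟨hu.1, by omega⟩ ha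
    subst this
    omega

/-- A vertex separated from the root by the edge `p y`, with `y` a child of `p`, lies below `y`. -/
theorem dist_root_of_children (hG : G.IsTree) {p y : V} (hy : y ∈ children G o p) :
    ∀ (n : ℕ) (x : V), G.dist y x = n → p ∈ children G x y → G.dist o x = G.dist o y + n := by
  intro n
  induction n using Nat.strong_induction_on with
  | _ n ih =>
    intro x hxn hx
    by_cases hxy : x = y
    · subst hxy
      rw [SimpleGraph.dist_self] at hxn
      omega
    obtain ⟨u, hu⟩ := exists_parent hG hxy
    have hu2 := hu.2
    have hx2 := hx.2
    rw [G.dist_comm (u := x), G.dist_comm (u := x)] at hx2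
    have hup : p ∈ children G u y := by
      refine ⟨hy.1.symm, ?_⟩
      have h1 := hG.connected.dist_triangle (u := p) (v := u) (w := x)
      have h2 := hG.connected.dist_triangle (u := p) (v := y) (w := u)
      rw [SimpleGraph.dist_eq_one_iff_adj.2 hu.1] at h1
      rw [SimpleGraph.dist_eq_one_iff_adj.2 hy.1] at h2
      rw [G.dist_comm (u := u), G.dist_comm (u := u)]
      omega
    have hou := ih (G.dist y u) (by omega) u rfl hup
    rcases adj_iff_children hG o hu.1 with h | h
    · have := h.2
      omega
    -- Here `x` would be the parent of `u` as seen from the root. That parent is `p` if `u = y`, and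
    -- otherwise the vertex `t` before `u` on the path from `y`.
    · exfalso
      by_cases huy : u = y
      · subst huy
        have := parent_unique hG h hy
        subst this
        rw [SimpleGraph.dist_self] at hx2
        omega
      · obtain ⟨t, ht⟩ := exists_parent hG huy
        have ht2 := ht.2
        have htp : p ∈ children G t y := by
          have hup2 := hup.2
          rw [G.dist_comm (u := u), G.dist_comm (u := u)] at hup2
          refine ⟨hy.1.symm, ?_⟩
          have h1 := hG.connected.dist_triangle (u := p) (v := t) (w := u)
          have h2 := hG.connected.dist_triangle (u := p) (v := y) (w := t)
          rw [SimpleGraph.dist_eq_one_iff_adj.2 ht.1] at h1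
          rw [SimpleGraph.dist_eq_one_iff_adj.2 hy.1] at h2
          rw [G.dist_comm (u := t), G.dist_comm (u := t)]
          omega
        have hot := ih (G.dist y t) (by omega) t rfl htp
        have : u ∈ children G o t := ⟨ht.1, by omega⟩
        have := parent_unique hG h this
        subst this
        omega

/-- A vertex `y ≠ x` that is at least as far from the root as `x` has its parent on the path
to `x`. -/
theorem mem_children_of_dist_le (hG : G.IsTree) {p x y : V} (hy : y ∈ children G o p)
    (hxy : x ≠ y) (hle : G.dist o x ≤ G.dist o y) : y ∈ children G x p := by
  rcases adj_iff_children hG x hy.1 with h | h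
  · exact h
  · have h1 := dist_root_of_children hG hy _ x rfl h
    have h2 : G.dist y x ≠ 0 := fun h0 => hxy (hG.connected.dist_eq_zero_iff.1 h0).symm
    omega

/-- The sequence that defines the height is eventually constant. -/
theorem eventually_height (hG : G.IsTree) (w : Boundary G o) (x : V) :
    ∀ᶠ m : ℕ in atTop, (m : ℤ) - G.dist x (w.1 m) = height G o w x := by
  set a : ℕ → ℤ := fun m => (m : ℤ) - G.dist x (w.1 m) with ha
  have hmono : Monotone a := by
    refine monotone_nat_of_le_succ fun m => ?_
    have := hG.connected.dist_triangle (u := x) (v := w.1 m) (w := w.1 (m + 1))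
    rw [SimpleGraph.dist_eq_one_iff_adj.2 (w.2.2.1 m)] at this
    simp only [ha]
    push_cast
    omega
  have hbdd : BddAbove (Set.range a) := by
    refine ⟨G.dist o x, ?_⟩
    rintro _ ⟨m, rfl⟩
    have := hG.connected.dist_triangle (u := o) (v := x) (w := w.1 m)
    rw [dist_ray] at this
    simp only [ha]
    omega
  have ht : Tendsto a atTop (𝓝 (⨆ m, a m)) := tendsto_atTop_ciSup hmono hbdd
  have hl : height G o w x = ⨆ m, a m := ht.limUnder_eq
  rw [hl]
  rw [nhds_discrete] at ht
  exact tendsto_pure.1 ht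

theorem height_eq (hG : G.IsTree) (w : Boundary G o) (x : V) {c : ℤ}
    (h : ∀ᶠ m : ℕ in atTop, (m : ℤ) - G.dist x (w.1 m) = c) : height G o w x = c := by
  obtain ⟨m, h1, h2⟩ := (h.and (eventually_height hG w x)).exists
  rw [← h2, h1]

theorem dist_of_mem_cyl {w : Boundary G o} {x : V} (hw : w ∈ cyl G o x) {m : ℕ}
    (hm : G.dist o x ≤ m) : G.dist x (w.1 m) = m - G.dist o x := by
  rw [mem_cyl_iff] at hw
  have := w.2.2.2 _ _ hm
  rwa [hw] at this

theorem height_of_mem_cyl (hG : G.IsTree) {w : Boundary G o} {x : V} (hw : w ∈ cyl G o x) :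
    height G o w x = G.dist o x := by
  refine height_eq hG w x ?_
  filter_upwards [eventually_ge_atTop (G.dist o x)] with m hm
  rw [dist_of_mem_cyl hw hm]
  omega

theorem cyl_root : cyl G o o = Set.univ := Set.eq_univ_of_forall fun w => ⟨0, w.2.1⟩

theorem height_root (hG : G.IsTree) (w : Boundary G o) : height G o w o = 0 := by
  rw [height_of_mem_cyl hG (by rw [cyl_root]; trivial), SimpleGraph.dist_self]
  rfl

theorem cyl_subset_of_children (hG : G.IsTree) {p y : V} (hy : y ∈ children G o p) :
    cyl G o y ⊆ cyl G o p := by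
  intro w hw
  rw [mem_cyl_iff, hy.2] at hw
  have := mem_children_ray w (G.dist o p)
  rw [hw] at this
  rw [mem_cyl_iff]
  exact parent_unique hG this hy

theorem height_of_mem_cyl_children (hG : G.IsTree) {w : Boundary G o} {p y : V}
    (hy : y ∈ children G o p) (hw : w ∈ cyl G o y) :
    height G o w y = height G o w p + 1 := by
  rw [height_of_mem_cyl hG hw, height_of_mem_cyl hG (cyl_subset_of_children hG hy hw), hy.2]
  push_cast
  rfl

/-- The ray starts on the side of `p` and could change sides only along the edge `p y`, hence
through `y`. So `y` stays one step further than `p` from every vertex of the ray. -/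
theorem height_of_notMem_cyl_children (hG : G.IsTree) {w : Boundary G o} {p y : V}
    (hy : y ∈ children G o p) (hw : w ∉ cyl G o y) :
    height G o w y = height G o w p - 1 := by
  have key : ∀ m, y ∈ children G (w.1 m) p := by
    intro m
    induction m with
    | zero =>
      rw [w.2.1]
      exact hy
    | succ m ih =>
      rcases adj_iff_children hG (w.1 (m + 1)) hy.1 with h | h
      · exact h
      · exact absurd ⟨_, (eq_of_children_of_children hG (w.2.2.1 m) ih h).2⟩ hw
  refine height_eq hG w y ?_
  filter_upwards [eventually_height hG w p] with m hm
  have := (key m).2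
  rw [G.dist_comm (u := y), this, ← hm, G.dist_comm (u := p)]
  push_cast
  ring

/-- Beyond `y`, the height of a vertex `x` that is not below `y` is determined by its distance
to `y`. -/
theorem height_of_children_of_mem_cyl (hG : G.IsTree) {w : Boundary G o} {p x y : V}
    (hy : y ∈ children G o p) (hx : y ∈ children G x p) (hw : w ∈ cyl G o y) :
    height G o w x = G.dist o y - G.dist x y := by
  have hwp : w.1 (G.dist o p) = p := (mem_cyl_iff w).1 (cyl_subset_of_children hG hy hw)
  have hwy : w.1 (G.dist o p + 1) = y := by
    rw [← hy.2]
    exact (mem_cyl_iff w).1 hw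
  have key : ∀ k, w.1 (G.dist o p + k + 1) ∈ children G x (w.1 (G.dist o p + k)) ∧
      G.dist x (w.1 (G.dist o p + k + 1)) = G.dist x y + k := by
    intro k
    induction k with
    | zero => simpa [hwp, hwy] using hx
    | succ k ih =>
      have hc : w.1 (G.dist o p + (k + 1) + 1) ∈ children G x (w.1 (G.dist o p + (k + 1))) := by
        rcases adj_iff_children hG x (w.2.2.1 (G.dist o p + (k + 1))) with h | h
        · exact h
        -- A step towards `x` would return to the vertex that the ray has just left.
        · exfalso
          have h1 := parent_unique hG h ih.1
          have h2 := dist_ray w (G.dist o p + (k + 1) + 1)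
          rw [h1, dist_ray] at h2
          omega
      refine ⟨hc, ?_⟩
      rw [hc.2, ← add_assoc, ih.2]
      ring
  refine height_eq hG w x ?_
  filter_upwards [eventually_ge_atTop (G.dist o p + 1)] with m hm
  obtain ⟨k, rfl⟩ := Nat.exists_eq_add_of_le hm
  have := (key k).2
  rw [show G.dist o p + 1 + k = G.dist o p + k + 1 by ring, this, hy.2]
  push_cast
  ring

theorem abs_height_le (hG : G.IsTree) (w : Boundary G o) (x : V) :
    |height G o w x| ≤ G.dist o x := by
  obtain ⟨m, hm⟩ := (eventually_height hG w x).exists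
  have h1 := hG.connected.dist_triangle (u := o) (v := x) (w := w.1 m)
  have h2 := hG.connected.dist_triangle (u := x) (v := o) (w := w.1 m)
  rw [dist_ray, G.dist_comm (u := x) (v := o)] at h2
  rw [dist_ray] at h1
  rw [abs_le]
  omega

/-- Summing a function of the height over the neighbours. -/
theorem sum_neighbors_height [G.LocallyFinite] {q : ℕ} (hG : G.IsTree)
    (hreg : G.IsRegularOfDegree (q + 1)) (w : Boundary G o) (x : V) (F : ℤ → ℂ) :
    ∑ y ∈ G.neighborFinset x, F (height G o w y) =
      F (height G o w x + 1) + q * F (height G o w x - 1) := by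
  classical
  -- For `m` large all heights involved are `m - d(·, ω_m)`; then the neighbour of `x` towards `ω_m`
  -- is one higher and the other `q` are one lower.
  have hev : ∀ᶠ m : ℕ in atTop, ∀ y ∈ insert x (G.neighborFinset x),
      (m : ℤ) - G.dist y (w.1 m) = height G o w y :=
    (Filter.eventually_all_finset _).2 fun y _ => eventually_height hG w y
  obtain ⟨m, hm, hmx⟩ := (hev.and (eventually_gt_atTop (G.dist o x))).exists
  have hx : x ≠ w.1 m := by
    intro h
    have := dist_ray w m
    rw [← h] at this
    omega
  obtain ⟨p, hp⟩ := exists_parent hG hx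
  have hpx : p ∈ G.neighborFinset x := by
    rw [SimpleGraph.mem_neighborFinset]
    exact hp.1.symm
  have hhx := hm x (Finset.mem_insert_self _ _)
  rw [← Finset.add_sum_erase _ _ hpx]
  have hhp := hm p (Finset.mem_insert_of_mem hpx)
  have hp2 := hp.2
  rw [G.dist_comm (u := w.1 m), G.dist_comm (u := w.1 m)] at hp2
  rw [show height G o w p = height G o w x + 1 by omega]
  congr 1
  have hcard : ((G.neighborFinset x).erase p).card = q := by
    rw [Finset.card_erase_of_mem hpx, SimpleGraph.card_neighborFinset_eq_degree, hreg x]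
    rfl
  rw [← nsmul_eq_mul, ← hcard]
  refine Finset.sum_eq_card_nsmul fun y hy => ?_
  obtain ⟨hyp, hyx⟩ := Finset.mem_erase.1 hy
  have hhy := hm y (Finset.mem_insert_of_mem hyx)
  rw [SimpleGraph.mem_neighborFinset] at hyx
  rcases adj_iff_children hG (w.1 m) hyx with h | h
  · have h2 := h.2
    rw [G.dist_comm (u := w.1 m), G.dist_comm (u := w.1 m)] at h2
    rw [show height G o w y = height G o w x - 1 by omega]
  · exact absurd (parent_unique hG h hp) hyp

theorem measurableSet_cyl (x : V) : MeasurableSet (cyl G o x) :=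
  MeasurableSpace.measurableSet_generateFrom ⟨x, rfl⟩

theorem measurable_height (hG : G.IsTree) (x : V) :
    Measurable fun w : Boundary G o => height G o w x := by
  classical
  induction h : G.dist o x generalizing x with
  | zero =>
    have : x = o := (hG.connected.dist_eq_zero_iff.1 h).symm
    subst this
    simp only [height_root hG]
    exact measurable_const
  | succ n ih =>
    have hxo : x ≠ o := by
      rintro rfl
      simp at h
    obtain ⟨p, hp⟩ := exists_parent hG hxo
    have hp2 := hp.2
    have hm := ih p (by omega)
    have : (fun w : Boundary G o => height G o w x) = fun w =>
        if w ∈ cyl G o x then height G o w p + 1 else height G o w p - 1 := by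
      ext w
      split_ifs with hw
      · exact height_of_mem_cyl_children hG hp hw
      · exact height_of_notMem_cyl_children hG hp hw
    rw [this]
    exact Measurable.ite (measurableSet_cyl x) (hm.add_const 1) (hm.sub_const 1)

/-- Allows almost everywhere statements, one for each vertex, to be combined. -/
theorem countable_vertices [G.LocallyFinite] (hG : G.IsTree) (o : V) : Countable V := by
  have hfin : ∀ n, {x | G.dist o x = n}.Countable := by
    intro n
    induction n with
    | zero =>
      refine (Set.countable_singleton o).mono fun x hx => ?_
      exact (hG.connected.dist_eq_zero_iff.1 hx).symm
    | succ n ih =>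
      refine (ih.biUnion fun x _ => (Set.toFinite (G.neighborSet x)).countable).mono fun x hx => ?_
      have hx' : G.dist o x = n + 1 := hx
      have hxo : x ≠ o := by
        rintro rfl
        simp at hx'
      obtain ⟨p, hp⟩ := exists_parent hG hxo
      have hp2 := hp.2
      exact Set.mem_biUnion (show G.dist o p = n by omega) hp.1
  rw [← Set.countable_univ_iff]
  exact (Set.countable_iUnion hfin).mono fun x _ => Set.mem_iUnion.2 ⟨G.dist o x, Set.mem_ofPred_eq ▸ rfl⟩

end HomTree

/-! ### The waves as powers of `q^(1/2+is)`. -/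

namespace HomTree

variable {V : Type*} {G : SimpleGraph V} {o : V}

/-- The number `q ^ (1/2 + i s)`. -/
noncomputable def waveBase (q : ℕ) (s : ℝ) : ℂ := (q : ℂ) ^ (1 / 2 + Complex.I * s)

/-- The number `q ^ (i s)` on the unit circle. -/
noncomputable def phase (q : ℕ) (s : ℝ) : ℂ := circleMap 0 1 (s * Real.log q)

theorem phase_eq (q : ℕ) (s : ℝ) : phase q s = Complex.exp (s * Real.log q * Complex.I) := by
  simp [phase, circleMap]

theorem norm_phase (q : ℕ) (s : ℝ) : ‖phase q s‖ = 1 := by simp [phase]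

theorem phase_ne_zero (q : ℕ) (s : ℝ) : phase q s ≠ 0 := by
  rw [phase_eq]
  exact Complex.exp_ne_zero _

theorem conj_phase (q : ℕ) (s : ℝ) : starRingEnd ℂ (phase q s) = (phase q s)⁻¹ := by
  rw [Complex.inv_def, Complex.normSq_eq_norm_sq, norm_phase]
  simp

theorem continuous_phase (q : ℕ) : Continuous (phase q) := by
  unfold phase
  fun_prop

theorem natCast_cpow {q : ℕ} (hq : 2 ≤ q) (a : ℝ) (s : ℝ) :
    (q : ℂ) ^ ((a : ℂ) + Complex.I * s) = ((q : ℝ) ^ a : ℝ) * phase q s := by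
  have hq0 : (q : ℂ) ≠ 0 := by
    have : q ≠ 0 := by omega
    exact_mod_cast this
  rw [Complex.cpow_add _ _ hq0, Complex.ofReal_cpow (by positivity), Complex.ofReal_natCast,
    phase_eq, Complex.cpow_def_of_ne_zero hq0 (Complex.I * s), ← Complex.natCast_log]
  congr 2
  ring

theorem waveBase_eq {q : ℕ} (hq : 2 ≤ q) (s : ℝ) :
    waveBase q s = (Real.sqrt q : ℂ) * phase q s := by
  have := natCast_cpow hq (1 / 2) s
  rw [Real.sqrt_eq_rpow, ← this, waveBase]
  push_cast
  rfl

theorem conj_waveBase {q : ℕ} (hq : 2 ≤ q) (s : ℝ) :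
    starRingEnd ℂ (waveBase q s) = (Real.sqrt q : ℂ) * (phase q s)⁻¹ := by
  rw [waveBase_eq hq, map_mul, conj_phase, Complex.conj_ofReal]

theorem sqrt_sq_natCast (q : ℕ) : (Real.sqrt q : ℂ) ^ 2 = q := by
  rw [← Complex.ofReal_pow, Real.sq_sqrt (by positivity), Complex.ofReal_natCast]

theorem sqrt_natCast_ne_zero {q : ℕ} (hq : 2 ≤ q) : (Real.sqrt q : ℂ) ≠ 0 := by
  have : (0 : ℝ) < q := by
    have : 0 < q := by omega
    exact_mod_cast this
  exact_mod_cast (Real.sqrt_pos.2 this).ne'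

theorem waveBase_ne_zero {q : ℕ} (hq : 2 ≤ q) (s : ℝ) : waveBase q s ≠ 0 := by
  rw [waveBase_eq hq]
  exact mul_ne_zero (sqrt_natCast_ne_zero hq) (phase_ne_zero q s)

theorem continuous_waveBase {q : ℕ} (hq : 2 ≤ q) : Continuous (waveBase q) := by
  rw [funext (waveBase_eq hq)]
  exact continuous_const.mul (continuous_phase q)

theorem norm_waveBase {q : ℕ} (hq : 2 ≤ q) (s : ℝ) : ‖waveBase q s‖ = Real.sqrt q := by
  rw [waveBase_eq hq, norm_mul, norm_phase, mul_one, Complex.norm_real, Real.norm_of_nonneg]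
  positivity

theorem one_lt_sqrt_natCast {q : ℕ} (hq : 2 ≤ q) : 1 < Real.sqrt q := by
  rw [Real.lt_sqrt zero_le_one]
  have : (2 : ℝ) ≤ q := by exact_mod_cast hq
  linarith

theorem wave_eq (q : ℕ) (x : V) (z : Boundary G o × ℝ) :
    wave G q o x z = waveBase q z.2 ^ height G o z.1 x := by
  rw [wave, waveBase, Complex.cpow_mul_int]

theorem waveBar_eq {q : ℕ} (hq : 2 ≤ q) (x : V) (z : Boundary G o × ℝ) :
    waveBar G q o x z = starRingEnd ℂ (wave G q o x z) := by
  rw [wave_eq, map_zpow₀, waveBar, Complex.cpow_mul_int]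
  congr 1
  have h := natCast_cpow hq (1 / 2) (-z.2)
  rw [conj_waveBase hq, Real.sqrt_eq_rpow]
  have h2 : phase q (-z.2) = (phase q z.2)⁻¹ := by
    rw [phase_eq, phase_eq, ← Complex.exp_neg]
    push_cast
    ring_nf
  rw [← h2, ← h]
  push_cast
  ring_nf

theorem wave_ne_zero {q : ℕ} (hq : 2 ≤ q) (x : V) (z : Boundary G o × ℝ) :
    wave G q o x z ≠ 0 := by
  rw [wave_eq]
  exact zpow_ne_zero _ (waveBase_ne_zero hq _)

theorem waveBar_ne_zero {q : ℕ} (hq : 2 ≤ q) (x : V) (z : Boundary G o × ℝ) :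
    waveBar G q o x z ≠ 0 := by
  rw [waveBar_eq hq]
  exact (map_ne_zero _).2 (wave_ne_zero hq x z)

theorem norm_wave_le {q : ℕ} (hq : 2 ≤ q) (hG : G.IsTree) (x : V) (z : Boundary G o × ℝ) :
    ‖wave G q o x z‖ ≤ Real.sqrt q ^ (G.dist o x) := by
  rw [wave_eq, norm_zpow, norm_waveBase hq, ← zpow_natCast]
  exact zpow_le_zpow_right₀ (one_lt_sqrt_natCast hq).le (abs_le.1 (abs_height_le hG z.1 x)).2

theorem measurable_wave {q : ℕ} (hq : 2 ≤ q) (hG : G.IsTree) (x : V) :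
    Measurable (wave G q o x) := by
  have h1 : Measurable fun z : Boundary G o × ℝ => height G o z.1 x :=
    (measurable_height hG x).comp measurable_fst
  have h2 : Measurable fun z : Boundary G o × ℝ => waveBase q z.2 :=
    (continuous_waveBase hq).measurable.comp measurable_snd
  have : Measurable fun p : ℂ × ℤ => p.1 ^ p.2 := by
    refine measurable_from_prod_countable_left fun n => ?_
    exact measurable_id.pow_const n
  rw [funext (wave_eq q x)]
  exact this.comp (h2.prodMk h1)

theorem wave_root (q : ℕ) (hG : G.IsTree) (z : Boundary G o × ℝ) : wave G q o o z = 1 := by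
  rw [wave_eq, height_root hG, zpow_zero]

/-! ### Integrals over the boundary and spherical functions. -/

section Angular

variable {q : ℕ} {ν : Measure (Boundary G o)}

/-- Each height takes only finitely many values, so any function of two of them is bounded. -/
theorem integrable_comp_height₂ (hG : G.IsTree) [IsFiniteMeasure ν] (x y : V)
    (F : ℤ → ℤ → ℂ) : Integrable (fun w => F (height G o w x) (height G o w y)) ν := by
  have hm : Measurable fun w => F (height G o w x) (height G o w y) :=
    (measurable_of_countable fun p : ℤ × ℤ => F p.1 p.2).comp
      ((measurable_height hG x).prodMk (measurable_height hG y))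
  refine Integrable.of_bound hm.aestronglyMeasurable
    (∑ i ∈ Finset.Icc (-(G.dist o x : ℤ)) (G.dist o x),
      ∑ j ∈ Finset.Icc (-(G.dist o y : ℤ)) (G.dist o y), ‖F i j‖) (ae_of_all _ fun w => ?_)
  have h1 : height G o w x ∈ Finset.Icc (-(G.dist o x : ℤ)) (G.dist o x) :=
    Finset.mem_Icc.2 (abs_le.1 (abs_height_le hG w x))
  have h2 : height G o w y ∈ Finset.Icc (-(G.dist o y : ℤ)) (G.dist o y) :=
    Finset.mem_Icc.2 (abs_le.1 (abs_height_le hG w y))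
  refine le_trans ?_ (Finset.single_le_sum (f := fun i =>
    ∑ j ∈ Finset.Icc (-(G.dist o y : ℤ)) (G.dist o y), ‖F i j‖) (fun i _ => by positivity) h1)
  exact Finset.single_le_sum (f := fun j => ‖F (height G o w x) j‖) (fun j _ => by positivity) h2

theorem IsBoundaryMeasure.real_cyl (hν : IsBoundaryMeasure G q o ν) {x : V} (hx : x ≠ o) :
    ν.real (cyl G o x) = q / ((q + 1) * q ^ G.dist o x) := by
  rw [Measure.real, hν.2 x hx]
  simp [ENNReal.toReal_add]

theorem ne_root_of_children {p y : V} (hy : y ∈ children G o p) : y ≠ o := by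
  rintro rfl
  have := hy.2
  simp at this

/-- Moving the second vertex one step away from the first one. -/
theorem integral_zpow_height_step (hq : 2 ≤ q) (hG : G.IsTree) (hν : IsBoundaryMeasure G q o ν)
    {z z' : ℂ} (hz : z * z' = q) {p x y : V} (hy : y ∈ children G o p)
    (hx : y ∈ children G x p) :
    ∫ w, z ^ height G o w x * z' ^ height G o w y ∂ν =
      z'⁻¹ * ∫ w, z ^ height G o w x * z' ^ height G o w p ∂ν +
        (1 - z'⁻¹ ^ 2) * (q / (q + 1)) * z⁻¹ ^ G.dist x y := by
  have := hν.1
  have hq0 : (q : ℂ) ≠ 0 := by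
    have : q ≠ 0 := by omega
    exact_mod_cast this
  have hz0 : z ≠ 0 := by
    rintro rfl
    simp at hz
    exact hq0 hz.symm
  have hz0' : z' ≠ 0 := by
    rintro rfl
    simp at hz
    exact hq0 hz.symm
  -- Off `E(y)` the height drops by one from `p` to `y`, which costs a factor `z'⁻¹`; on `E(y)` all
  -- three heights are constant, so the correction is a constant on `E(y)`. Since `z z' = q`, it
  -- contains `q^|y|`, which cancels against `ν(E(y))`.
  have hpt : ∀ w : Boundary G o, z ^ height G o w x * z' ^ height G o w y =
      z'⁻¹ * (z ^ height G o w x * z' ^ height G o w p) +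
        (cyl G o y).indicator
          (fun _ => (1 - z'⁻¹ ^ 2) * (q : ℂ) ^ G.dist o y * z⁻¹ ^ G.dist x y) w := by
    intro w
    by_cases hw : w ∈ cyl G o y
    · rw [Set.indicator_of_mem hw, height_of_children_of_mem_cyl hG hy hx hw,
        height_of_mem_cyl hG hw, height_of_mem_cyl hG (cyl_subset_of_children hG hy hw), hy.2,
        zpow_sub₀ hz0, ← hz]
      simp only [zpow_natCast, mul_pow, inv_pow, pow_succ]
      field_simp
      ring
    · rw [Set.indicator_of_notMem hw, height_of_notMem_cyl_children hG hy hw, zpow_sub_one₀ hz0']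
      ring
  rw [integral_congr_ae (ae_of_all _ hpt), integral_add, integral_const_mul,
    integral_indicator_const _ (measurableSet_cyl y), hν.real_cyl (ne_root_of_children hy)]
  · congr 1
    rw [Complex.real_smul]
    push_cast
    field_simp
  · exact (integrable_comp_height₂ hG x p fun i j => z ^ i * z' ^ j).const_mul _
  · exact (integrable_const _).indicator (measurableSet_cyl y)

/-- The Poisson kernel has total mass `1`. -/
theorem integral_natCast_zpow_height (hq : 2 ≤ q) (hG : G.IsTree)
    (hν : IsBoundaryMeasure G q o ν) (x : V) :
    ∫ w, (q : ℂ) ^ height G o w x ∂ν = 1 := by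
  have := hν.1
  induction h : G.dist o x generalizing x with
  | zero =>
    have : x = o := (hG.connected.dist_eq_zero_iff.1 h).symm
    subst this
    simp [height_root hG]
  | succ n ih =>
    have hxo : x ≠ o := by
      rintro rfl
      simp at h
    obtain ⟨p, hp⟩ := exists_parent hG hxo
    -- With `z = 1` the first vertex, here the root, drops out of the integrand.
    have hstep := integral_zpow_height_step (z := 1) (z' := q) hq hG hν (one_mul _) hp hp
    simp only [one_zpow, one_mul, inv_one, one_pow, mul_one] at hstep
    rw [hstep, ih p (by have := hp.2; omega)]
    have hq0 : (q : ℂ) ≠ 0 := by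
      have : q ≠ 0 := by omega
      exact_mod_cast this
    have hq1 : (q : ℂ) + 1 ≠ 0 := by exact_mod_cast Nat.succ_ne_zero q
    field_simp
    ring

/-- The coefficient of `w ^ d` in the spherical function. -/
noncomputable def sphericalCoeff (q : ℕ) (w : ℂ) : ℂ :=
  (q * w - w⁻¹) / ((q + 1) * (w - w⁻¹))

/-- With `r` a square root of `q`, the one-step formula gives a first order recursion in `d`
starting from the mass of the Poisson kernel, and the two exponentials solve it. It moves the vertex
further from the root; if that is `x`, the vertices are exchanged, which amounts to `w ↦ w⁻¹`. The
condition `w² ≠ 1` avoids the poles of the coefficients. -/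
theorem integral_zpow_height (hq : 2 ≤ q) (hG : G.IsTree) (hν : IsBoundaryMeasure G q o ν)
    {r : ℂ} (hr : r ^ 2 = q) :
    ∀ (d : ℕ) (w : ℂ) (x y : V), w ≠ 0 → w ^ 2 ≠ 1 → G.dist x y = d →
      ∫ b, (r * w) ^ height G o b x * (r * w⁻¹) ^ height G o b y ∂ν =
        r⁻¹ ^ d * (sphericalCoeff q w * w ^ d + sphericalCoeff q w⁻¹ * w⁻¹ ^ d) := by
  have hq0 : (q : ℂ) ≠ 0 := by
    have : q ≠ 0 := by omega
    exact_mod_cast this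
  have hq1 : (q : ℂ) + 1 ≠ 0 := by exact_mod_cast Nat.succ_ne_zero q
  have hr0 : r ≠ 0 := by
    rintro rfl
    simp at hr
    exact hq0 hr.symm
  have hrr : ∀ w : ℂ, w ≠ 0 → r * w * (r * w⁻¹) = q := by
    intro w hw
    rw [← hr]
    field_simp
  intro d
  induction d with
  | zero =>
    intro w x y hw hw2 hxy
    have : x = y := hG.connected.dist_eq_zero_iff.1 hxy
    subst this
    simp only [← mul_zpow, hrr w hw, integral_natCast_zpow_height hq hG hν x]
    have h1 : w ^ 2 - 1 ≠ 0 := sub_ne_zero.2 hw2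
    have h2 : 1 - w ^ 2 ≠ 0 := sub_ne_zero.2 (Ne.symm hw2)
    simp only [sphericalCoeff, inv_inv, pow_zero, one_mul, mul_one]
    rw [show w⁻¹ - w = -(w - w⁻¹) by ring, show w - w⁻¹ = (w ^ 2 - 1) / w by field_simp]
    field_simp
    ring
  | succ d ih =>
    have key : ∀ (w : ℂ) (x y : V), w ≠ 0 → w ^ 2 ≠ 1 → G.dist x y = d + 1 →
        G.dist o x ≤ G.dist o y →
        ∫ b, (r * w) ^ height G o b x * (r * w⁻¹) ^ height G o b y ∂ν =
          r⁻¹ ^ (d + 1) *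
            (sphericalCoeff q w * w ^ (d + 1) + sphericalCoeff q w⁻¹ * w⁻¹ ^ (d + 1)) := by
      intro w x y hw hw2 hxy hle
      have hne : x ≠ y := by
        rintro rfl
        simp at hxy
      have hyo : y ≠ o := by
        rintro rfl
        rw [SimpleGraph.dist_self, Nat.le_zero] at hle
        exact hne (hG.connected.dist_eq_zero_iff.1 hle).symm
      obtain ⟨p, hp⟩ := exists_parent hG hyo
      have hxp := mem_children_of_dist_le hG hp hne hle
      have hd := hxp.2
      rw [integral_zpow_height_step hq hG hν (hrr w hw) hp hxp,
        ih w x p hw hw2 (by omega), hxy]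
      have h1 : w ^ 2 - 1 ≠ 0 := sub_ne_zero.2 hw2
      simp only [sphericalCoeff, inv_inv, mul_inv, mul_pow, inv_pow, pow_succ]
      rw [show w⁻¹ - w = -(w - w⁻¹) by ring, show w - w⁻¹ = (w ^ 2 - 1) / w by field_simp, ← hr]
      rw [← hr] at hq1
      have : w ^ d ≠ 0 := pow_ne_zero _ hw
      have : r ^ d ≠ 0 := pow_ne_zero _ hr0
      generalize w ^ d = A at *
      generalize r ^ d = B at *
      field_simp
      ring
    intro w x y hw hw2 hxy
    rcases le_total (G.dist o x) (G.dist o y) with hle | hle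
    · exact key w x y hw hw2 hxy hle
    · rw [G.dist_comm] at hxy
      have := key w⁻¹ y x (inv_ne_zero hw) (by rwa [inv_pow, Ne, inv_eq_one]) hxy hle
      rw [inv_inv] at this
      rw [add_comm (sphericalCoeff q w * w ^ (d + 1)), ← this]
      simp only [mul_comm]

end Angular

end HomTree

/-! ### The Plancherel measure and the orthonormality of the waves. -/

namespace HomTree

variable {V : Type*} {G : SimpleGraph V} {o : V} {q : ℕ}

theorem one_lt_natCast (hq : 2 ≤ q) : (1 : ℝ) < q := by
  have : 1 < q := by omega
  exact_mod_cast this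

theorem log_natCast_pos (hq : 2 ≤ q) : 0 < Real.log q := Real.log_pos (one_lt_natCast hq)

theorem natCast_sub_ne_zero (hq : 2 ≤ q) {a : ℂ} (ha : ‖a‖ ≤ 1) : (q : ℂ) - a ≠ 0 := by
  intro h
  have h1 : ‖a‖ = q := by rw [← sub_eq_zero.1 h, Complex.norm_natCast]
  have := one_lt_natCast hq
  linarith

/-- The outer factor `q^(1/2)` is absorbed into the numerator. Where `w² = 1`, both sides are `0` by
the convention for division. -/
theorem cFun_eq (hq : 2 ≤ q) (s : ℝ) : cFun q s = sphericalCoeff q (phase q s) := by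
  have h1 := natCast_cpow hq (1 / 2) s
  have h2 := natCast_cpow hq 0 s
  rw [← Real.sqrt_eq_rpow] at h1
  have h3 : (q : ℂ) ^ (-(1 / 2) - Complex.I * (s : ℂ)) = (Real.sqrt q * phase q s : ℂ)⁻¹ := by
    rw [← h1, ← Complex.cpow_neg]
    push_cast
    ring_nf
  have h4 : (q : ℂ) ^ (1 / 2 : ℂ) = Real.sqrt q := by
    rw [Real.sqrt_eq_rpow, Complex.ofReal_cpow (by positivity)]
    push_cast
    rfl
  push_cast at h1 h2
  simp only [zero_add, Real.rpow_zero, Complex.ofReal_one, one_mul] at h2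
  have hs := sqrt_natCast_ne_zero hq
  have hss := sqrt_sq_natCast q
  have hw := phase_ne_zero q s
  have hq1 : (q : ℂ) + 1 ≠ 0 := by exact_mod_cast Nat.succ_ne_zero q
  rw [cFun, h1, h3, h4, Complex.cpow_neg, h2, sphericalCoeff, div_mul_div_comm]
  congr 1
  rw [mul_sub, mul_inv, ← mul_assoc, ← mul_assoc, mul_inv_cancel₀ hs, ← sq, hss, one_mul]

/-- The density of the Plancherel measure. -/
noncomputable def plancherelDensity (q : ℕ) (s : ℝ) : ℝ :=
  q * Real.log q / (2 * Real.pi * (q + 1)) * (‖cFun q s‖ ^ 2)⁻¹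

theorem plancherelDensity_nonneg (hq : 2 ≤ q) (s : ℝ) : 0 ≤ plancherelDensity q s := by
  have := log_natCast_pos hq
  unfold plancherelDensity
  positivity

/-- The poles of `c` become zeros of the numerator here, and the denominator never vanishes, so this
form shows that the density is continuous. -/
theorem plancherelDensity_eq (hq : 2 ≤ q) (s : ℝ) :
    plancherelDensity q s = q * Real.log q / (2 * Real.pi * (q + 1)) *
      ((q + 1) ^ 2 * ‖phase q s - (phase q s)⁻¹‖ ^ 2 / ‖q * phase q s - (phase q s)⁻¹‖ ^ 2) := by
  have hq1 : ‖(q : ℂ) + 1‖ = q + 1 := by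
    rw [← Nat.cast_succ, Complex.norm_natCast]
    push_cast
    rfl
  rw [plancherelDensity, cFun_eq hq, sphericalCoeff, norm_div, norm_mul, hq1, div_pow, inv_div,
    mul_pow]

theorem continuous_plancherelDensity (hq : 2 ≤ q) : Continuous (plancherelDensity q) := by
  rw [funext (plancherelDensity_eq hq)]
  have h1 := continuous_phase q
  have h2 : Continuous fun s => (phase q s)⁻¹ := h1.inv₀ (phase_ne_zero q)
  refine continuous_const.mul (Continuous.div (by fun_prop) (by fun_prop) fun s => ?_)
  refine pow_ne_zero _ (norm_ne_zero_iff.2 ?_)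
  have hw := phase_ne_zero q s
  have : (q : ℂ) * phase q s - (phase q s)⁻¹ =
      phase q s * (q - (phase q s)⁻¹ ^ 2) := by
    field_simp
  rw [this]
  refine mul_ne_zero hw (natCast_sub_ne_zero hq ?_)
  rw [norm_pow, norm_inv, norm_phase]
  norm_num

theorem plancherel_eq (q : ℕ) : plancherel q =
    (volume.restrict (Set.Icc 0 (Real.pi / Real.log q))).withDensity
      fun s => ENNReal.ofReal (plancherelDensity q s) := rfl

theorem isFiniteMeasure_plancherel (hq : 2 ≤ q) : IsFiniteMeasure (plancherel q) := by
  rw [plancherel_eq]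
  refine isFiniteMeasure_withDensity_ofReal ?_
  exact ((continuous_plancherelDensity hq).continuousOn.integrableOn_compact
    isCompact_Icc).2

theorem integral_plancherel (hq : 2 ≤ q) (F : ℝ → ℂ) :
    ∫ s, F s ∂(plancherel q) =
      ∫ s in (0 : ℝ)..(Real.pi / Real.log q), (plancherelDensity q s : ℂ) * F s := by
  rw [plancherel_eq, integral_withDensity_eq_integral_toReal_smul,
    intervalIntegral.integral_of_le (div_nonneg Real.pi_pos.le (log_natCast_pos hq).le),
    integral_Icc_eq_integral_Ioc]
  · refine integral_congr_ae (ae_of_all _ fun s => ?_)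
    simp only [ENNReal.toReal_ofReal (plancherelDensity_nonneg hq s), Complex.real_smul]
  · exact (continuous_plancherelDensity hq).measurable.ennreal_ofReal
  · exact ae_of_all _ fun _ => ENNReal.ofReal_lt_top

theorem ae_plancherel_mem (q : ℕ) :
    ∀ᵐ s ∂(plancherel q), s ∈ Set.Icc 0 (Real.pi / Real.log q) := by
  rw [plancherel_eq]
  exact (withDensity_absolutelyContinuous _ _).ae_le (ae_restrict_mem measurableSet_Icc)

/-- The function in the unit disc whose boundary values are, up to normalization, the monomials
divided by the reflected `c`-function. -/
noncomputable def discFun (q d : ℕ) (w : ℂ) : ℂ := w ^ d * (1 - w ^ 2) / (q - w ^ 2)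

theorem differentiableAt_discFun (hq : 2 ≤ q) (d : ℕ) {w : ℂ} (hw : ‖w‖ ≤ 1) :
    DifferentiableAt ℂ (discFun q d) w := by
  unfold discFun
  refine DifferentiableAt.div (by fun_prop) (by fun_prop) (natCast_sub_ne_zero hq ?_)
  rw [norm_pow]
  exact pow_le_one₀ (norm_nonneg _) hw

theorem continuous_discFun_circleMap (hq : 2 ≤ q) (d : ℕ) :
    Continuous fun θ : ℝ => discFun q d (circleMap 0 1 θ) := by
  refine continuous_iff_continuousAt.2 fun θ => ?_
  exact ContinuousAt.comp (f := fun θ : ℝ => circleMap 0 1 θ)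
    (differentiableAt_discFun hq d (by simp)).continuousAt (by fun_prop)

theorem integral_discFun (hq : 2 ≤ q) (d : ℕ) :
    ∫ θ in (0 : ℝ)..2 * Real.pi, discFun q d (circleMap 0 1 θ) =
      2 * Real.pi * discFun q d 0 := by
  have h : Real.circleAverage (discFun q d) 0 1 = discFun q d 0 := by
    refine DiffContOnCl.circleAverage (DifferentiableOn.diffContOnCl fun w hw => ?_)
    rw [abs_one, closure_ball _ one_ne_zero, mem_closedBall_zero_iff] at hw
    exact (differentiableAt_discFun hq d hw).differentiableWithinAt
  rw [← h, Real.circleAverage_def, Complex.real_smul]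
  have := Real.pi_pos.ne'
  push_cast
  field_simp

/-- The reflection `θ ↦ 2π - θ` turns `w` into `w⁻¹`, so the two terms on the half circle make up
one full circle. -/
theorem integral_discFun_add (hq : 2 ≤ q) (d : ℕ) :
    ∫ θ in (0 : ℝ)..Real.pi,
      (discFun q d (circleMap 0 1 θ) + discFun q d (circleMap 0 1 θ)⁻¹) =
        2 * Real.pi * discFun q d 0 := by
  have hc := continuous_discFun_circleMap hq d
  have hinv : ∀ θ : ℝ, (circleMap 0 1 θ)⁻¹ = circleMap 0 1 (2 * Real.pi - θ) := by
    intro θ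
    rw [circleMap_zero_inv, inv_one, sub_eq_neg_add, periodic_circleMap]
  have hc' : Continuous fun θ : ℝ => discFun q d (circleMap 0 1 (2 * Real.pi - θ)) :=
    hc.comp (continuous_const.sub continuous_id)
  simp only [hinv]
  rw [intervalIntegral.integral_add (hc.intervalIntegrable _ _) (hc'.intervalIntegrable _ _),
    intervalIntegral.integral_comp_sub_left (fun θ => discFun q d (circleMap 0 1 θ)),
    show 2 * Real.pi - Real.pi = Real.pi by ring, sub_zero,
    intervalIntegral.integral_add_adjacent_intervals (hc.intervalIntegrable _ _)
      (hc.intervalIntegrable _ _), integral_discFun hq]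

theorem phase_sq_ne_one (hq : 2 ≤ q) {s : ℝ} (hs : s ∈ Set.Ioo 0 (Real.pi / Real.log q)) :
    phase q s ^ 2 ≠ 1 := by
  have hl := log_natCast_pos hq
  intro h
  rw [phase_eq, ← Complex.exp_nat_mul, Complex.exp_eq_one_iff] at h
  obtain ⟨n, hn⟩ := h
  have h2 : s * Real.log q = n * Real.pi := by
    have h3 : (2 * Complex.I) * (s * Real.log q : ℝ) = (2 * Complex.I) * (n * Real.pi : ℝ) := by
      push_cast
      push_cast at hn
      linear_combination hn
    exact_mod_cast mul_left_cancel₀ (by simp) h3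
  have h0 : 0 < s * Real.log q := mul_pos hs.1 hl
  have h1 : s * Real.log q < Real.pi := (lt_div_iff₀ hl).1 hs.2
  rw [h2] at h0 h1
  have hp := Real.pi_pos
  have h4 : 0 < n := by
    have : (0 : ℝ) < n := pos_of_mul_pos_left h0 hp.le
    exact_mod_cast this
  have h5 : (1 : ℝ) ≤ n := by exact_mod_cast h4
  nlinarith

/-- On the unit circle `|c|² = c(w) c(w⁻¹)`, so division leaves `w^d / c(w⁻¹) + w^(-d) / c(w)`. Here
`1 / c(w⁻¹) = (q+1)(1-w²)/(q-w²)` has no pole in the closed disc, as `q > 1`. -/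
theorem plancherelDensity_mul_spherical (hq : 2 ≤ q) (d : ℕ) {s : ℝ} (hs : phase q s ^ 2 ≠ 1) :
    (plancherelDensity q s : ℂ) * (sphericalCoeff q (phase q s) * phase q s ^ d +
      sphericalCoeff q (phase q s)⁻¹ * (phase q s)⁻¹ ^ d) =
    q * Real.log q / (2 * Real.pi) *
      (discFun q d (phase q s) + discFun q d (phase q s)⁻¹) := by
  have hw := phase_ne_zero q s
  have hn := norm_phase q s
  have hconj : starRingEnd ℂ (sphericalCoeff q (phase q s)) =
      sphericalCoeff q (phase q s)⁻¹ := by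
    simp only [sphericalCoeff, map_div₀, map_sub, map_mul, map_inv₀, conj_phase, map_add, map_one,
      map_natCast]
  have hnorm : ((‖cFun q s‖ ^ 2 : ℝ) : ℂ) =
      sphericalCoeff q (phase q s) * sphericalCoeff q (phase q s)⁻¹ := by
    rw [cFun_eq hq, ← hconj, Complex.mul_conj, Complex.normSq_eq_norm_sq]
  rw [plancherelDensity, Complex.ofReal_mul, Complex.ofReal_inv, hnorm]
  have hA : (q : ℂ) - phase q s ^ 2 ≠ 0 :=
    natCast_sub_ne_zero hq (by rw [norm_pow, hn]; norm_num)
  have hB : (q : ℂ) - (phase q s)⁻¹ ^ 2 ≠ 0 :=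
    natCast_sub_ne_zero hq (by rw [norm_pow, norm_inv, hn]; norm_num)
  generalize phase q s = w at *
  have hq1 : (q : ℂ) + 1 ≠ 0 := by exact_mod_cast Nat.succ_ne_zero q
  have h1 : w ^ 2 - 1 ≠ 0 := sub_ne_zero.2 hs
  have hB' : (q : ℂ) * w ^ 2 - 1 ≠ 0 := by
    have : (q : ℂ) * w ^ 2 - 1 = w ^ 2 * (q - w⁻¹ ^ 2) := by field_simp
    rw [this]
    exact mul_ne_zero (pow_ne_zero _ hw) hB
  have hp : (Real.pi : ℂ) ≠ 0 := by exact_mod_cast Real.pi_pos.ne'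
  have e1 : sphericalCoeff q w = (q * w ^ 2 - 1) / ((q + 1) * (w ^ 2 - 1)) := by
    rw [sphericalCoeff, show w - w⁻¹ = (w ^ 2 - 1) / w by field_simp]
    field_simp
  have e2 : sphericalCoeff q w⁻¹ = (w ^ 2 - q) / ((q + 1) * (w ^ 2 - 1)) := by
    rw [sphericalCoeff, inv_inv, show w⁻¹ - w = -((w ^ 2 - 1) / w) by field_simp; ring]
    field_simp
    ring
  have e3 : discFun q d w = w ^ d * (w ^ 2 - 1) / (w ^ 2 - q) := by
    rw [discFun, ← neg_sub (w ^ 2), ← neg_sub (w ^ 2), mul_neg, neg_div_neg_eq]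
  have e4 : discFun q d w⁻¹ = w⁻¹ ^ d * (w ^ 2 - 1) / (q * w ^ 2 - 1) := by
    rw [discFun, show (q : ℂ) - w⁻¹ ^ 2 = (q * w ^ 2 - 1) / w ^ 2 by field_simp]
    field_simp
  have hA' : w ^ 2 - (q : ℂ) ≠ 0 := by
    rw [← neg_sub]
    exact neg_ne_zero.2 hA
  rw [e1, e2, e3, e4]
  generalize w ^ d = A at *
  generalize w⁻¹ ^ d = B at *
  push_cast
  field_simp

/-- After substituting `θ = s log q`, the mean value property evaluates the integral at the centre
of the disc, where `discFun q d` is `1/q` if `d = 0` and `0` otherwise. This is why `r` does not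
matter. -/
theorem integral_spherical (hq : 2 ≤ q) (d : ℕ) {r : ℂ} :
    ∫ s, r⁻¹ ^ d * (sphericalCoeff q (phase q s) * phase q s ^ d +
      sphericalCoeff q (phase q s)⁻¹ * (phase q s)⁻¹ ^ d) ∂(plancherel q) =
        if d = 0 then 1 else 0 := by
  have hl := log_natCast_pos hq
  rw [integral_const_mul, integral_plancherel hq]
  have h1 : ∫ s in (0 : ℝ)..(Real.pi / Real.log q), (plancherelDensity q s : ℂ) *
      (sphericalCoeff q (phase q s) * phase q s ^ d +
        sphericalCoeff q (phase q s)⁻¹ * (phase q s)⁻¹ ^ d) =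
      ∫ s in (0 : ℝ)..(Real.pi / Real.log q), q * Real.log q / (2 * Real.pi) *
        (discFun q d (circleMap 0 1 (s * Real.log q)) +
          discFun q d (circleMap 0 1 (s * Real.log q))⁻¹) := by
    rw [intervalIntegral.integral_of_le (by positivity),
      intervalIntegral.integral_of_le (by positivity), integral_Ioc_eq_integral_Ioo,
      integral_Ioc_eq_integral_Ioo]
    exact setIntegral_congr_fun measurableSet_Ioo fun s hs =>
      plancherelDensity_mul_spherical hq d (phase_sq_ne_one hq hs)
  rw [h1, intervalIntegral.integral_const_mul,
    intervalIntegral.integral_comp_mul_right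
      (fun θ => discFun q d (circleMap 0 1 θ) + discFun q d (circleMap 0 1 θ)⁻¹) hl.ne',
    zero_mul, div_mul_cancel₀ _ hl.ne', integral_discFun_add hq, Complex.real_smul]
  have hq0 : (q : ℂ) ≠ 0 := by
    have : q ≠ 0 := by omega
    exact_mod_cast this
  have hl' : (Real.log q : ℂ) ≠ 0 := by exact_mod_cast hl.ne'
  have hp : (Real.pi : ℂ) ≠ 0 := by exact_mod_cast Real.pi_pos.ne'
  by_cases hd : d = 0
  · subst hd
    rw [Complex.natCast_log] at hl'
    simp only [discFun, if_pos]
    push_cast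
    field_simp
    simpa using hq0
  · simp [discFun, hd]

variable [G.LocallyFinite]

theorem isFiniteMeasure_dualMeasure (hq : 2 ≤ q) (hG : G.IsTree)
    (hreg : G.IsRegularOfDegree (q + 1)) : IsFiniteMeasure (dualMeasure G q o) := by
  have := (isBoundaryMeasure_boundaryMeasure hq hG hreg o).1
  have := isFiniteMeasure_plancherel hq
  unfold dualMeasure
  infer_instance

theorem integrable_wave_mul_conj (hq : 2 ≤ q) (hG : G.IsTree)
    (hreg : G.IsRegularOfDegree (q + 1)) (x y : V) :
    Integrable (fun z => wave G q o x z * starRingEnd ℂ (wave G q o y z))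
      (dualMeasure G q o) := by
  have := isFiniteMeasure_dualMeasure (o := o) hq hG hreg
  refine Integrable.of_bound ((measurable_wave hq hG x).mul
    (Complex.continuous_conj.measurable.comp (measurable_wave hq hG y))).aestronglyMeasurable
    (Real.sqrt q ^ (G.dist o x) * Real.sqrt q ^ (G.dist o y)) (ae_of_all _ fun z => ?_)
  rw [norm_mul, RCLike.norm_conj]
  exact mul_le_mul (norm_wave_le hq hG x z) (norm_wave_le hq hG y z) (norm_nonneg _)
    (by positivity)

open Classical in
/-- The waves are orthonormal. -/
theorem integral_wave_mul_conj (hq : 2 ≤ q) (hG : G.IsTree)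
    (hreg : G.IsRegularOfDegree (q + 1)) (x y : V) :
    ∫ z, wave G q o x z * starRingEnd ℂ (wave G q o y z) ∂(dualMeasure G q o) =
      if x = y then 1 else 0 := by
  have hν := isBoundaryMeasure_boundaryMeasure hq hG hreg o
  have := hν.1
  have := isFiniteMeasure_plancherel hq
  have hint := integrable_wave_mul_conj (o := o) hq hG hreg x y
  rw [dualMeasure] at hint ⊢
  rw [integral_prod_symm _ hint]
  -- The spherical formula fails only at the two end points of the frequency interval.
  have hae : ∀ᵐ s ∂(plancherel q), phase q s ^ 2 ≠ 1 := by
    rw [plancherel_eq]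
    refine (withDensity_absolutelyContinuous _ _).ae_le ?_
    rw [restrict_Ioo_eq_restrict_Icc.symm]
    exact (ae_restrict_mem measurableSet_Ioo).mono fun s hs => phase_sq_ne_one hq hs
  have hd : (if x = y then (1 : ℂ) else 0) = if G.dist x y = 0 then 1 else 0 := by
    simp only [hG.connected.dist_eq_zero_iff]
  rw [hd, ← integral_spherical hq (G.dist x y) (r := (Real.sqrt q : ℂ))]
  refine integral_congr_ae (hae.mono fun s hs => ?_)
  simp only [wave_eq, map_zpow₀, conj_waveBase hq]
  rw [← integral_zpow_height hq hG hν (sqrt_sq_natCast q) _ _ x y (phase_ne_zero q s) hs rfl]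
  simp only [waveBase_eq hq]

end HomTree

/-! ### The transform as an isometry, and superpositions of transforms. -/

namespace HomTree

variable {V : Type*} {G : SimpleGraph V} {o : V} {q : ℕ} [G.LocallyFinite]

theorem memLp_wave (hq : 2 ≤ q) (hG : G.IsTree) (hreg : G.IsRegularOfDegree (q + 1)) (x : V)
    (p : ℝ≥0∞) : MemLp (wave G q o x) p (dualMeasure G q o) := by
  have := isFiniteMeasure_dualMeasure (o := o) hq hG hreg
  exact MemLp.of_bound (measurable_wave hq hG x).aestronglyMeasurable _
    (ae_of_all _ fun z => norm_wave_le hq hG x z)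

theorem orthonormal_wave (hq : 2 ≤ q) (hG : G.IsTree) (hreg : G.IsRegularOfDegree (q + 1)) :
    Orthonormal ℂ fun x => (memLp_wave (o := o) hq hG hreg x 2).toLp := by
  classical
  rw [orthonormal_iff_ite]
  intro x y
  rw [L2.inner_def]
  -- The inner product is conjugate linear in its first argument, hence the order `y`, `x`.
  have h := integral_wave_mul_conj (o := o) hq hG hreg y x
  rw [if_congr (eq_comm (a := x) (b := y)) rfl rfl]
  convert h using 1
  refine integral_congr_ae ?_
  filter_upwards [(memLp_wave (o := o) hq hG hreg x 2).coeFn_toLp,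
    (memLp_wave (o := o) hq hG hreg y 2).coeFn_toLp] with z h1 h2
  rw [h1, h2, RCLike.inner_apply]

/-- The Fourier-Helgason transform as an isometry of Hilbert spaces. -/
noncomputable def helgason (o : V) (hq : 2 ≤ q) (hG : G.IsTree)
    (hreg : G.IsRegularOfDegree (q + 1)) :
    lp (fun _ : V => ℂ) 2 →ₗᵢ[ℂ] Lp ℂ 2 (dualMeasure G q o) :=
  (orthonormal_wave hq hG hreg).orthogonalFamily.linearIsometry

theorem hasSum_helgason (hq : 2 ≤ q) (hG : G.IsTree) (hreg : G.IsRegularOfDegree (q + 1))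
    (f : lp (fun _ : V => ℂ) 2) :
    HasSum (fun x => f x • (memLp_wave (o := o) hq hG hreg x 2).toLp)
      (helgason o hq hG hreg f) :=
  (orthonormal_wave hq hG hreg).orthogonalFamily.hasSum_linearIsometry f

theorem memLp_sum_wave (hq : 2 ≤ q) (hG : G.IsTree) (hreg : G.IsRegularOfDegree (q + 1))
    (f : V → ℂ) (A : Finset V) (p : ℝ≥0∞) :
    MemLp (fun z => ∑ y ∈ A, f y * wave G q o y z) p (dualMeasure G q o) :=
  memLp_finsetSum _ fun y _ => (memLp_wave hq hG hreg y p).const_mul (f y)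

theorem isL2Transform_iff (hq : 2 ≤ q) (hG : G.IsTree) (hreg : G.IsRegularOfDegree (q + 1))
    (f : lp (fun _ : V => ℂ) 2) {F : Boundary G o × ℝ → ℂ}
    (hF : MemLp F 2 (dualMeasure G q o)) :
    IsL2Transform G q o f F ↔ hF.toLp = helgason o hq hG hreg f := by
  have h1 : ∀ A : Finset V, (memLp_sum_wave (o := o) hq hG hreg f A 2).toLp =
      ∑ x ∈ A, f x • (memLp_wave (o := o) hq hG hreg x 2).toLp := by
    intro A
    refine Lp.ext ?_
    have hc : ∀ᵐ z ∂(dualMeasure G q o), ∀ x ∈ A,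
        (f x • (memLp_wave (o := o) hq hG hreg x 2).toLp : Lp ℂ 2 (dualMeasure G q o)) z =
          f x * wave G q o x z := by
      refine (ae_ball_iff A.countable_toSet).2 fun x _ => ?_
      filter_upwards [Lp.coeFn_smul (f x) (memLp_wave (o := o) hq hG hreg x 2).toLp,
        (memLp_wave (o := o) hq hG hreg x 2).coeFn_toLp] with z h2 h3
      rw [h2, Pi.smul_apply, h3, smul_eq_mul]
    filter_upwards [hc, (memLp_sum_wave (o := o) hq hG hreg f A 2).coeFn_toLp,
      Lp.coeFn_fun_finsetSum A fun x => f x • (memLp_wave (o := o) hq hG hreg x 2).toLp]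
      with z h2 h3 h4
    rw [h3, h4]
    exact Finset.sum_congr rfl fun x hx => (h2 x hx).symm
  have h2 : Tendsto (fun A : Finset V => (memLp_sum_wave (o := o) hq hG hreg f A 2).toLp) atTop
      (𝓝 (helgason o hq hG hreg f)) := by
    simp only [h1]
    exact hasSum_helgason hq hG hreg f
  have h3 : IsL2Transform G q o f F ↔
      Tendsto (fun A : Finset V => (memLp_sum_wave (o := o) hq hG hreg f A 2).toLp) atTop
        (𝓝 hF.toLp) := by
    rw [Lp.tendsto_Lp_iff_tendsto_eLpNorm'' _ (memLp_sum_wave (o := o) hq hG hreg f · 2) F hF,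
      IsL2Transform, and_iff_right hF]
    refine tendsto_congr fun A => ?_
    rw [eLpNorm_sub_comm]
    rfl
  rw [h3]
  constructor
  · intro h
    exact tendsto_nhds_unique h h2
  · intro h
    rwa [h]

/-- On `ℓ²` the transform is a representative of the isometry. -/
theorem transform_ae_eq (hq : 2 ≤ q) (hG : G.IsTree) (hreg : G.IsRegularOfDegree (q + 1))
    (f : lp (fun _ : V => ℂ) 2) :
    transform G q o f =ᵐ[dualMeasure G q o] helgason o hq hG hreg f := by
  -- Both branches of the definition satisfy the `L²` limit that determines the class: for finite
  -- support the truncations are eventually equal to the transform.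
  have key : IsL2Transform G q o f (transform G q o f) := by
    by_cases hf : (Function.support (f : V → ℂ)).Finite
    · have ht : ∀ A : Finset V, hf.toFinset ⊆ A →
          transform G q o f = fun z => ∑ y ∈ A, f y * wave G q o y z := by
        intro A hA
        rw [transform, if_pos hf]
        ext z
        refine finsum_eq_sum_of_support_subset _ fun y hy => ?_
        refine hA (hf.mem_toFinset.2 fun h => hy ?_)
        simp [h]
      refine ⟨?_, ?_⟩
      · rw [ht _ subset_rfl]
        exact memLp_sum_wave hq hG hreg f _ 2
      · refine tendsto_const_nhds.congr' ?_
        filter_upwards [eventually_ge_atTop hf.toFinset] with A hA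
        rw [ht A hA]
        simp
    · have hex : ∃ F, IsL2Transform G q o f F :=
        ⟨_, (isL2Transform_iff hq hG hreg f (Lp.memLp (helgason o hq hG hreg f))).2
          (Lp.toLp_coeFn _ _)⟩
      rw [transform, if_neg hf, dif_pos hex]
      exact hex.choose_spec
  rw [← (isL2Transform_iff hq hG hreg f key.1).1 key]
  exact key.1.coeFn_toLp.symm

theorem memℓp_of_finite_support {f : V → ℂ} (hf : (Function.support f).Finite) (p : ℝ≥0∞) :
    Memℓp f p :=
  (memℓp_zero hf).of_exponent_ge (zero_le)

/-- Parseval's identity, for finitely supported second argument. -/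
theorem integral_conj_helgason_mul_transform (hq : 2 ≤ q) (hG : G.IsTree)
    (hreg : G.IsRegularOfDegree (q + 1)) (f u : lp (fun _ : V => ℂ) 2) :
    Integrable (fun z => starRingEnd ℂ (helgason o hq hG hreg f z) * transform G q o u z)
      (dualMeasure G q o) ∧
    ∫ z, starRingEnd ℂ (helgason o hq hG hreg f z) * transform G q o u z ∂(dualMeasure G q o) =
      inner ℂ f u := by
  have hu := transform_ae_eq (o := o) hq hG hreg u
  have he : (fun z => starRingEnd ℂ (helgason o hq hG hreg f z) * transform G q o u z)
      =ᵐ[dualMeasure G q o]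
        fun z => inner ℂ (helgason o hq hG hreg f z) (helgason o hq hG hreg u z) := by
    filter_upwards [hu] with z hz
    rw [hz, RCLike.inner_apply, mul_comm]
  refine ⟨(L2.integrable_inner _ _).congr he.symm, ?_⟩
  rw [integral_congr_ae he, ← L2.inner_def, LinearIsometry.inner_map_map]

/-- Superpositions of conjugate transforms. -/
theorem exists_hasSum_conj_transform (hq : 2 ≤ q) (hG : G.IsTree)
    (hreg : G.IsRegularOfDegree (q + 1)) (a : ℕ → lp (fun _ : V => ℂ) 2) (b : ℕ → ℂ)
    (hab : Summable fun k => ‖b k‖ * ‖a k‖) :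
    ∃ Φ : Boundary G o × ℝ → ℂ,
      (∀ᵐ z ∂(dualMeasure G q o),
        HasSum (fun k => starRingEnd ℂ (transform G q o (a k) z) * b k) (Φ z)) ∧
      ∀ u : lp (fun _ : V => ℂ) 2,
        Integrable (fun z => Φ z * transform G q o u z) (dualMeasure G q o) ∧
        HasSum (fun k => b k * inner ℂ (a k) u)
          (∫ z, Φ z * transform G q o u z ∂(dualMeasure G q o)) := by
  -- The scalars go inside: `∑ b_k conj(𝓗 a_k)` is the conjugate of `𝓗` at the single vector `∑
  -- conj(b_k) a_k` of `ℓ²`.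
  set A : ℕ → lp (fun _ : V => ℂ) 2 := fun k => starRingEnd ℂ (b k) • a k with hA
  have hAn : ∀ k, ‖A k‖ = ‖b k‖ * ‖a k‖ := fun k => by
    rw [hA, norm_smul, RCLike.norm_conj]
  have hAs : Summable A := Summable.of_norm (by simpa only [hAn] using hab)
  set H := helgason o hq hG hreg
  have hHs : HasSum (fun k => H (A k)) (H (∑' k, A k)) :=
    hAs.hasSum.map H.toLinearMap.toAddMonoidHom H.continuous
  -- Summability of the `L²` norms makes the series converge pointwise almost everywhere, to the
  -- `L²` sum.
  have hfin : ∑' k, ‖H (A k)‖ₑ ≠ ∞ := by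
    have : Summable fun k => ‖H (A k)‖₊ := by
      rw [← NNReal.summable_coe]
      simpa only [coe_nnnorm, LinearIsometry.norm_map, hAn] using hab
    simpa only [enorm_eq_nnnorm] using ENNReal.tsum_coe_ne_top_iff_summable.2 this
  refine ⟨fun z => starRingEnd ℂ (H (∑' k, A k) z), ?_, fun u => ?_⟩
  · have h1 : ∀ᵐ z ∂(dualMeasure G q o), ∀ k,
        H (A k) z = starRingEnd ℂ (b k) * transform G q o (a k) z := by
      refine ae_all_iff.2 fun k => ?_
      filter_upwards [transform_ae_eq (o := o) hq hG hreg (a k),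
        Lp.coeFn_smul (starRingEnd ℂ (b k)) (H (a k))] with z h2 h3
      rw [hA, LinearIsometry.map_smul, h3, Pi.smul_apply, smul_eq_mul, h2]
    filter_upwards [h1, Lp.hasSum_coeFn_tsum hfin] with z h2 h3
    rw [hHs.tsum_eq] at h3
    have h4 : HasSum (fun k => starRingEnd ℂ (H (A k) z)) (starRingEnd ℂ (H (∑' k, A k) z)) :=
      h3.map (starRingEnd ℂ).toAddMonoidHom Complex.continuous_conj
    simp only [h2, map_mul, Complex.conj_conj] at h4
    simpa only [mul_comm] using h4
  · obtain ⟨h1, h2⟩ := integral_conj_helgason_mul_transform (o := o) hq hG hreg (∑' k, A k) u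
    refine ⟨h1, ?_⟩
    rw [h2]
    have h3 : HasSum (fun k => starRingEnd ℂ (inner ℂ u (A k)))
        (starRingEnd ℂ (inner ℂ u (∑' k, A k))) :=
      ((hAs.hasSum.mapL (innerSL ℂ u))).map (starRingEnd ℂ).toAddMonoidHom Complex.continuous_conj
    simp only [inner_conj_symm] at h3
    convert h3 using 2 with k
    rw [hA, inner_smul_left, Complex.conj_conj]

theorem norm_lp_two (a : lp (fun _ : V => ℂ) 2) : ‖a‖ = Real.sqrt (∑' y, ‖a y‖ ^ 2) := by
  rw [lp.norm_eq_tsum_rpow (by norm_num), Real.sqrt_eq_rpow]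
  norm_num

end HomTree

/-! ### The waves separate integrable functions. -/

namespace HomTree

variable {V : Type*} {G : SimpleGraph V} {o : V} {q : ℕ}

/-- An integrable function on the dual of the radial algebra is determined by its moments. -/
theorem ae_eq_zero_of_moments (hq : 2 ≤ q) {g : ℝ → ℂ} (hg : Integrable g (plancherel q))
    (h : ∀ n : ℕ, ∫ s, g s * (Real.cos (s * Real.log q) : ℂ) ^ n ∂(plancherel q) = 0) :
    g =ᵐ[plancherel q] 0 := by
  have hl := log_natCast_pos hq
  have := isFiniteMeasure_plancherel hq
  have hbdd : ∀ φ : ℝ → ℝ, Continuous φ → Integrable (fun s => g s * (φ (Real.cos (s * Real.log q))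
      : ℂ)) (plancherel q) := by
    intro φ hφ
    obtain ⟨C, hC⟩ := isCompact_Icc (a := (-1 : ℝ)) (b := 1) |>.exists_bound_of_continuousOn
      hφ.continuousOn
    refine hg.mul_bdd (c := C) ?_ (ae_of_all _ fun s => ?_)
    · exact (Complex.continuous_ofReal.comp (hφ.comp (Real.continuous_cos.comp
        (continuous_id.mul continuous_const)))).aestronglyMeasurable
    · rw [Complex.norm_real]
      exact hC _ ⟨Real.neg_one_le_cos _, Real.cos_le_one _⟩
  -- The vanishing passes from powers of the cosine to polynomials, then by Weierstrass to
  -- continuous functions of it.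
  have hpoly : ∀ P : Polynomial ℝ,
      ∫ s, g s * ((P.eval (Real.cos (s * Real.log q)) : ℝ) : ℂ) ∂(plancherel q) = 0 := by
    intro P
    induction P using Polynomial.induction_on' with
    | add P Q hP hQ =>
      simp only [Polynomial.eval_add, Complex.ofReal_add, mul_add]
      rw [integral_add (hbdd _ P.continuous) (hbdd _ Q.continuous), hP, hQ, add_zero]
    | monomial n a =>
      simp only [Polynomial.eval_monomial, Complex.ofReal_mul, Complex.ofReal_pow,
        mul_left_comm (g _)]
      rw [integral_const_mul, h n, mul_zero]
  have hcont : ∀ φ : ℝ → ℝ, Continuous φ →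
      ∫ s, g s * (φ (Real.cos (s * Real.log q)) : ℂ) ∂(plancherel q) = 0 := by
    intro φ hφ
    have hle : ∀ ε : ℝ, 0 < ε →
        ‖∫ s, g s * (φ (Real.cos (s * Real.log q)) : ℂ) ∂(plancherel q)‖ ≤
          ε * ∫ s, ‖g s‖ ∂(plancherel q) := by
      intro ε hε
      obtain ⟨P, hP⟩ := exists_polynomial_near_of_continuousOn (-1) 1 φ hφ.continuousOn ε hε
      have h1 : ∫ s, g s * (φ (Real.cos (s * Real.log q)) : ℂ) ∂(plancherel q) =
          ∫ s, (g s * (φ (Real.cos (s * Real.log q)) : ℂ) -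
            g s * ((P.eval (Real.cos (s * Real.log q)) : ℝ) : ℂ)) ∂(plancherel q) := by
        rw [integral_sub (hbdd _ hφ) (hbdd _ P.continuous), hpoly, sub_zero]
      rw [h1, ← integral_const_mul]
      refine norm_integral_le_of_norm_le (hg.norm.const_mul ε) (ae_of_all _ fun s => ?_)
      rw [← mul_sub, norm_mul, mul_comm, ← Complex.ofReal_sub, Complex.norm_real, norm_sub_rev,
        Real.norm_eq_abs]
      exact mul_le_mul_of_nonneg_right
        (hP _ ⟨Real.neg_one_le_cos _, Real.cos_le_one _⟩).le (norm_nonneg _)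
    rw [← norm_le_zero_iff]
    refine le_of_forall_pos_le_add fun δ hδ => ?_
    have hI : 0 ≤ ∫ s, ‖g s‖ ∂(plancherel q) := integral_nonneg fun _ => norm_nonneg _
    refine (hle (δ / (1 + ∫ s, ‖g s‖ ∂(plancherel q))) (by positivity)).trans ?_
    rw [zero_add, div_mul_eq_mul_div, div_le_iff₀ (by positivity)]
    nlinarith
  refine ae_eq_zero_of_integral_contDiff_smul_eq_zero hg.locallyIntegrable fun ψ hψ _ => ?_
  -- On `[0, τ]` the frequency is a continuous function of `cos(s log q)`, so these functions
  -- include all test functions.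
  have h2 := hcont (fun t => ψ (Real.arccos t / Real.log q))
    (hψ.continuous.comp (Real.continuous_arccos.div_const _))
  rw [← h2]
  refine integral_congr_ae ((ae_plancherel_mem q).mono fun s hs => ?_)
  simp only
  rw [Real.arccos_cos (mul_nonneg hs.1 hl.le) ((le_div_iff₀ hl).1 hs.2),
    mul_div_cancel_right₀ _ hl.ne', Complex.real_smul, mul_comm]

theorem ray_eq_of_le (hG : G.IsTree) (w w' : Boundary G o) {n : ℕ} (h : w.1 n = w'.1 n) :
    ∀ m ≤ n, w.1 m = w'.1 m := by
  induction n with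
  | zero =>
    intro m hm
    rwa [Nat.le_zero.1 hm]
  | succ n ih =>
    intro m hm
    rcases hm.eq_or_lt with rfl | hm
    · exact h
    · refine ih (parent_unique hG (mem_children_ray w n) ?_) m (Nat.lt_succ_iff.1 hm)
      rw [h]
      exact mem_children_ray w' n

theorem isPiSystem_cyl (hG : G.IsTree) (o : V) : IsPiSystem (Set.range (cyl G o)) := by
  have key : ∀ x y, G.dist o x ≤ G.dist o y → (cyl G o x ∩ cyl G o y).Nonempty →
      cyl G o y ⊆ cyl G o x := by
    rintro x y hxy ⟨w, h1, h2⟩ w' h3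
    rw [mem_cyl_iff] at h1 h2 h3 ⊢
    rw [ray_eq_of_le hG w' w (h3.trans h2.symm) _ hxy, h1]
  rintro _ ⟨x, rfl⟩ _ ⟨y, rfl⟩ hxy
  rcases le_total (G.dist o x) (G.dist o y) with hle | hle
  · rw [Set.inter_eq_right.2 (key x y hle hxy)]
    exact ⟨y, rfl⟩
  · rw [Set.inter_comm] at hxy
    rw [Set.inter_eq_left.2 (key y x hle hxy)]
    exact ⟨x, rfl⟩

/-- The cylinders are a generating π-system; complements are handled by the total integral, which is
the one over the cylinder of the root. -/
theorem ae_eq_zero_of_setIntegral_cyl (hG : G.IsTree) {ν : Measure (Boundary G o)}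
    {f : Boundary G o → ℂ} (hf : Integrable f ν) (h : ∀ x, ∫ w in cyl G o x, f w ∂ν = 0) :
    f =ᵐ[ν] 0 := by
  refine hf.ae_eq_zero_of_forall_setIntegral_eq_zero fun A hA hfin => ?_
  clear hfin
  induction A, hA using MeasurableSpace.induction_on_inter (s := Set.range (cyl G o)) rfl
    (isPiSystem_cyl hG o) with
  | empty => simp
  | basic A hA =>
    obtain ⟨x, rfl⟩ := hA
    exact h x
  | compl A hA ih =>
    have h1 := integral_add_compl hA hf
    have h2 := h o
    rw [cyl_root, setIntegral_univ] at h2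
    rw [ih, h2, zero_add] at h1
    exact h1
  | iUnion A hd hA ih =>
    rw [integral_iUnion hA hd hf.integrableOn]
    simp [ih]

/-- For a fixed frequency the waves separate the integrable functions on the boundary. -/
theorem ae_eq_zero_of_integral_zpow_height (hG : G.IsTree) {ν : Measure (Boundary G o)}
    [IsFiniteMeasure ν] {f : Boundary G o → ℂ} (hf : Integrable f ν) {Z : ℂ} (hZ : 1 < ‖Z‖)
    (h : ∀ x, ∫ w, f w * Z ^ height G o w x ∂ν = 0) : f =ᵐ[ν] 0 := by
  have hZ0 : Z ≠ 0 := by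
    rintro rfl
    simp at hZ
    linarith
  refine ae_eq_zero_of_setIntegral_cyl hG hf fun y => ?_
  by_cases hy : y = o
  · subst hy
    rw [cyl_root, setIntegral_univ]
    simpa [height_root hG] using h y
  obtain ⟨p, hp⟩ := exists_parent hG hy
  -- `Z^h(y) - Z⁻¹ Z^h(p)` vanishes off `E(y)` and equals `K` on it; `|Z| > 1` excludes `Z = Z⁻¹`.
  set K : ℂ := Z ^ G.dist o p * (Z - Z⁻¹) with hK
  have hK0 : K ≠ 0 := by
    refine mul_ne_zero (pow_ne_zero _ hZ0) (sub_ne_zero.2 fun he => ?_)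
    have h1 : ‖Z‖ = ‖Z‖⁻¹ := by
      rw [← norm_inv, ← he]
    have h2 : ‖Z‖⁻¹ < 1 := inv_lt_one_of_one_lt₀ hZ
    linarith
  have hpt : ∀ w, f w * Z ^ height G o w y =
      Z⁻¹ * (f w * Z ^ height G o w p) + (cyl G o y).indicator (fun w => K * f w) w := by
    intro w
    by_cases hw : w ∈ cyl G o y
    · rw [Set.indicator_of_mem hw, height_of_mem_cyl_children hG hp hw,
        height_of_mem_cyl hG (cyl_subset_of_children hG hp hw), zpow_add_one₀ hZ0, zpow_natCast,
        hK]
      ring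
    · rw [Set.indicator_of_notMem hw, height_of_notMem_cyl_children hG hp hw, zpow_sub_one₀ hZ0]
      ring
  have hint : Integrable (fun w => f w * Z ^ height G o w p) ν := by
    refine hf.mul_bdd (c := ‖Z‖ ^ G.dist o p)
      (integrable_comp_height₂ hG p p fun i _ => Z ^ i).aestronglyMeasurable
      (ae_of_all _ fun w => ?_)
    rw [norm_zpow, ← zpow_natCast]
    exact zpow_le_zpow_right₀ hZ.le (abs_le.1 (abs_height_le hG w p)).2
  have h1 := h y
  rw [integral_congr_ae (ae_of_all _ hpt), integral_add (hint.const_mul _)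
    ((hf.const_mul K).indicator (measurableSet_cyl y)), integral_const_mul, h p, mul_zero,
    zero_add, integral_indicator (measurableSet_cyl y), integral_const_mul] at h1
  exact (mul_eq_zero.1 h1).resolve_left hK0

theorem integrable_mul_wave (hq : 2 ≤ q) (hG : G.IsTree) {F : Boundary G o × ℝ → ℂ}
    (hF : Integrable F (dualMeasure G q o)) (x : V) :
    Integrable (fun z => F z * wave G q o x z) (dualMeasure G q o) :=
  hF.mul_bdd (measurable_wave hq hG x).aestronglyMeasurable
    (ae_of_all _ fun z => norm_wave_le hq hG x z)

variable [G.LocallyFinite]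

/-- One neighbour is higher and `q` are lower, so with `Z = q^(1/2+is)` the eigenvalue is `Z + q Z⁻¹
= √q (w + w⁻¹)`. -/
theorem sum_neighbors_wave (hq : 2 ≤ q) (hG : G.IsTree) (hreg : G.IsRegularOfDegree (q + 1))
    (x : V) (z : Boundary G o × ℝ) :
    ∑ y ∈ G.neighborFinset x, wave G q o y z =
      2 * Real.sqrt q * (Real.cos (z.2 * Real.log q) : ℂ) * wave G q o x z := by
  simp only [wave_eq]
  rw [sum_neighbors_height hG hreg z.1 x fun n => waveBase q z.2 ^ n]
  have h0 := waveBase_ne_zero hq z.2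
  rw [zpow_add_one₀ h0, zpow_sub_one₀ h0]
  have hs := sqrt_natCast_ne_zero hq
  have h1 : (q : ℂ) * (waveBase q z.2)⁻¹ = Real.sqrt q * (phase q z.2)⁻¹ := by
    rw [waveBase_eq hq, ← sqrt_sq_natCast q, mul_inv, sq, mul_assoc, ← mul_assoc _ (_)⁻¹ _,
      mul_inv_cancel₀ hs, one_mul]
  have h2 : phase q z.2 + (phase q z.2)⁻¹ = 2 * (Real.cos (z.2 * Real.log q) : ℂ) := by
    rw [phase_eq, ← Complex.exp_neg, Complex.ofReal_cos, Complex.two_cos]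
    push_cast
    ring_nf
  calc _ = (waveBase q z.2 + q * (waveBase q z.2)⁻¹) *
        waveBase q z.2 ^ height G o z.1 x := by ring
    _ = (Real.sqrt q * (phase q z.2 + (phase q z.2)⁻¹)) *
        waveBase q z.2 ^ height G o z.1 x := by
      rw [h1, waveBase_eq hq, mul_add]
    _ = _ := by
      rw [h2]
      ring

/-- The waves separate the integrable functions on the dual. -/
theorem ae_eq_zero_of_integral_wave (hq : 2 ≤ q) (hG : G.IsTree)
    (hreg : G.IsRegularOfDegree (q + 1)) {F : Boundary G o × ℝ → ℂ}
    (hF : Integrable F (dualMeasure G q o))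
    (h : ∀ x, ∫ z, F z * wave G q o x z ∂(dualMeasure G q o) = 0) :
    F =ᵐ[dualMeasure G q o] 0 := by
  have hν := isBoundaryMeasure_boundaryMeasure hq hG hreg o
  have := hν.1
  have := isFiniteMeasure_plancherel hq
  have := countable_vertices hG o
  have hint : ∀ (n : ℕ) x, Integrable (fun z => F z * wave G q o x z *
      (Real.cos (z.2 * Real.log q) : ℂ) ^ n) (dualMeasure G q o) := by
    intro n x
    refine (integrable_mul_wave hq hG hF x).mul_bdd (c := 1) ?_ (ae_of_all _ fun z => ?_)
    · refine Measurable.aestronglyMeasurable ?_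
      fun_prop
    · rw [norm_pow, Complex.norm_real]
      exact pow_le_one₀ (norm_nonneg _) (Real.abs_cos_le_one _)
  -- Multiplying a wave by the cosine is, up to a constant, summing over neighbours, so each moment
  -- reduces to lower ones at nearby vertices.
  have hmom : ∀ (n : ℕ) x, ∫ z, F z * wave G q o x z *
      (Real.cos (z.2 * Real.log q) : ℂ) ^ n ∂(dualMeasure G q o) = 0 := by
    intro n
    induction n with
    | zero => simpa using h
    | succ n ih =>
      intro x
      have hs := sqrt_natCast_ne_zero hq
      have he : ∀ z : Boundary G o × ℝ, F z * wave G q o x z *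
          (Real.cos (z.2 * Real.log q) : ℂ) ^ (n + 1) = (2 * Real.sqrt q : ℂ)⁻¹ *
          ∑ y ∈ G.neighborFinset x, F z * wave G q o y z *
            (Real.cos (z.2 * Real.log q) : ℂ) ^ n := by
        intro z
        rw [← Finset.sum_mul, ← Finset.mul_sum, sum_neighbors_wave hq hG hreg]
        field_simp
        ring
      rw [integral_congr_ae (ae_of_all _ he), integral_const_mul,
        integral_finsetSum _ fun y _ => hint n y, Finset.sum_eq_zero fun y _ => ih y, mul_zero]
  rw [dualMeasure] at hF hint hmom ⊢
  have hG0 : ∀ x, ∀ᵐ s ∂(plancherel q),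
      ∫ w, F (w, s) * wave G q o x (w, s) ∂(boundaryMeasure G q o) = 0 := by
    intro x
    have h1 : Integrable (fun s => ∫ w, F (w, s) * wave G q o x (w, s) ∂(boundaryMeasure G q o))
        (plancherel q) := by
      have := hint 0 x
      simp only [pow_zero, mul_one] at this
      exact this.integral_prod_right
    refine ae_eq_zero_of_moments hq h1 fun n => ?_
    have h2 := hmom n x
    rw [integral_prod_symm _ (hint n x)] at h2
    simpa only [integral_mul_const] using h2
  have hsec : ∀ᵐ s ∂(plancherel q), ∫ w, ‖F (w, s)‖ ∂(boundaryMeasure G q o) = 0 := by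
    filter_upwards [ae_all_iff.2 hG0, hF.prod_left_ae] with s h1 h2
    have h3 : (fun w => F (w, s)) =ᵐ[boundaryMeasure G q o] 0 := by
      refine ae_eq_zero_of_integral_zpow_height hG h2 (Z := waveBase q s) ?_ fun x => ?_
      · rw [norm_waveBase hq]
        exact one_lt_sqrt_natCast hq
      · simpa only [wave_eq] using h1 x
    refine integral_eq_zero_of_ae (h3.mono fun w hw => ?_)
    simp [hw]
  -- Fubini for `‖F‖` turns vanishing on almost every section into vanishing almost everywhere.
  have h4 : ∫ z, ‖F z‖ ∂((boundaryMeasure G q o).prod (plancherel q)) = 0 := by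
    rw [integral_prod_symm _ hF.norm]
    exact integral_eq_zero_of_ae hsec
  rw [integral_eq_zero_iff_of_nonneg (fun _ => norm_nonneg _) hF.norm] at h4
  exact h4.mono fun z hz => norm_eq_zero.1 hz

end HomTree

/-! ### Duality of `ℓ^p` spaces and comparison with `ℓ²`. -/

namespace HomTree

variable {V : Type*}

theorem le_two_of_holderConjugate {p p' : ℝ≥0∞} [p'.HolderConjugate p] (hp : 2 ≤ p) : p' ≤ 2 := by
  by_contra! h
  have h1 := ENNReal.HolderConjugate.inv_add_inv_eq_one p' p
  have h2 : p'⁻¹ < 2⁻¹ := ENNReal.inv_lt_inv.2 h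
  have h3 : p⁻¹ ≤ 2⁻¹ := ENNReal.inv_le_inv.2 hp
  have h4 := ENNReal.add_lt_add_of_lt_of_le (ne_top_of_le_ne_top (by simp) h3) h2 h3
  rw [h1, ENNReal.inv_two_add_inv_two] at h4
  exact lt_irrefl _ h4

section Duality

variable {p p' : ℝ≥0∞} [Fact (1 ≤ p)] [Fact (1 ≤ p')]

theorem norm_mul_le_coe_one :
    ‖ContinuousLinearMap.mul ℂ ℂ‖ ≤ ((1 : NNReal) : ℝ) :=
  ContinuousLinearMap.opNorm_mul_le ℂ ℂ

/-- The bilinear pairing `(g, u) ↦ ∑_y g(y) u(y)` of conjugate `ℓ^p` spaces. -/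
noncomputable def lpPairing [p'.HolderConjugate p] :
    lp (fun _ : V => ℂ) p' →L[ℂ] lp (fun _ : V => ℂ) p →L[ℂ] ℂ :=
  lp.dualPairing p' p (fun _ => ContinuousLinearMap.mul ℂ ℂ) fun _ => norm_mul_le_coe_one

theorem lpPairing_apply [p'.HolderConjugate p] (g : lp (fun _ : V => ℂ) p')
    (u : lp (fun _ : V => ℂ) p) : lpPairing g u = ∑' y, g y * u y :=
  rfl

theorem norm_lpPairing_le [p'.HolderConjugate p] (g : lp (fun _ : V => ℂ) p') :
    ‖(lpPairing g : lp (fun _ : V => ℂ) p →L[ℂ] ℂ)‖ ≤ ‖g‖ := by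
  refine (ContinuousLinearMap.le_opNorm _ _).trans ?_
  refine mul_le_of_le_one_left (norm_nonneg _) ?_
  exact lp.norm_dualPairing (p := p') (q := p) (fun _ : V => ContinuousLinearMap.mul ℂ ℂ)
    fun _ => norm_mul_le_coe_one

/-- Test `φ` on the extremal vector of Hölder's inequality, with coordinates `conj(g_y)
|g_y|^(P'-2)`: then `φ(u) = ‖u‖^P = S`, the sum to be bounded, so `‖u‖^(P-1) ≤ ‖φ‖`. -/
theorem sum_rpow_dual_le [DecidableEq V] {P P' : ℝ} (hP : P.HolderConjugate P')
    (hpP : p.toReal = P) (φ : StrongDual ℂ (lp (fun _ : V => ℂ) p)) (A : Finset V) :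
    ∑ y ∈ A, ‖φ (lp.single p y 1)‖ ^ P' ≤ ‖φ‖ ^ P' := by
  set g : V → ℂ := fun y => φ (lp.single p y 1) with hg
  set S := ∑ y ∈ A, ‖g y‖ ^ P' with hS
  have hS0 : 0 ≤ S := Finset.sum_nonneg fun y _ => by positivity
  have hP'0 := hP.symm.pos
  set c : V → ℂ := fun y => starRingEnd ℂ (g y) / ‖g y‖ * (‖g y‖ ^ (P' - 1) : ℝ) with hc
  have hcn : ∀ y, ‖c y‖ = ‖g y‖ ^ (P' - 1) := by
    intro y
    by_cases h0 : g y = 0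
    · simp [hc, h0, Real.zero_rpow hP.symm.sub_one_ne_zero]
    · have : ‖g y‖ ≠ 0 := norm_ne_zero_iff.2 h0
      rw [hc, norm_mul, norm_div, RCLike.norm_conj, Complex.norm_real, norm_norm, div_self this,
        one_mul, Complex.norm_real, Real.norm_of_nonneg (by positivity)]
  have hcg : ∀ y, c y * g y = (‖g y‖ ^ P' : ℝ) := by
    intro y
    by_cases h0 : g y = 0
    · simp [hc, h0, Real.zero_rpow hP'0.ne']
    · have h1 : ‖g y‖ ≠ 0 := norm_ne_zero_iff.2 h0
      have h1' : (‖g y‖ : ℂ) ≠ 0 := by exact_mod_cast h1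
      have h2 : ‖g y‖ ^ P' = ‖g y‖ ^ (P' - 1) * ‖g y‖ := by
        rw [← Real.rpow_add_one h1, sub_add_cancel]
      have h3 : starRingEnd ℂ (g y) * g y = (‖g y‖ : ℂ) ^ 2 := by
        rw [mul_comm, Complex.mul_conj, Complex.normSq_eq_norm_sq]
        push_cast
        rfl
      rw [h2, hc]
      push_cast
      field_simp
      linear_combination ((‖g y‖ ^ (P' - 1) : ℝ) : ℂ) * h3
  set u : lp (fun _ : V => ℂ) p := ∑ y ∈ A, lp.single p y (c y) with hu
  have hφu : φ u = (S : ℂ) := by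
    rw [hu, map_sum, hS, Complex.ofReal_sum]
    refine Finset.sum_congr rfl fun y _ => ?_
    rw [← hcg, hg, ← smul_eq_mul, ← map_smul, ← lp.single_smul, smul_eq_mul, mul_one]
  have hun : ‖u‖ ^ P = S := by
    rw [hu, ← hpP, lp.norm_sum_single (by rw [hpP]; exact hP.pos), hS]
    refine Finset.sum_congr rfl fun y _ => ?_
    rw [hcn, hpP, ← Real.rpow_mul (norm_nonneg _), hP.symm.sub_one_mul_conj]
  have hle : S ≤ ‖φ‖ * ‖u‖ := by
    have := φ.le_opNorm u
    rwa [hφu, Complex.norm_real, Real.norm_of_nonneg hS0] at this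
  rcases hS0.eq_or_lt with h0 | hpos
  · rw [← h0]
    positivity
  have hu0 : 0 < ‖u‖ := by
    refine (norm_nonneg _).lt_of_ne fun h => ?_
    rw [← h, Real.zero_rpow hP.ne_zero] at hun
    exact hpos.ne hun
  have h1 : ‖u‖ ^ (P - 1) ≤ ‖φ‖ := by
    rw [Real.rpow_sub_one hu0.ne', hun]
    exact (div_le_iff₀ hu0).2 hle
  calc S = (‖u‖ ^ (P - 1)) ^ P' := by
        rw [← Real.rpow_mul hu0.le, hP.sub_one_mul_conj, hun]
    _ ≤ ‖φ‖ ^ P' := Real.rpow_le_rpow (by positivity) h1 hP'0.le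

/-- Every functional on `ℓ^p`, `p < ∞`, is given by an element of the conjugate space. -/
theorem exists_eq_lpPairing [p'.HolderConjugate p] (hp : p ≠ ⊤)
    (φ : StrongDual ℂ (lp (fun _ : V => ℂ) p)) :
    ∃ g : lp (fun _ : V => ℂ) p', ‖g‖ ≤ ‖φ‖ ∧ φ = lpPairing g := by
  classical
  have hp0 : 0 < p := zero_lt_one.trans_le Fact.out
  have hg : ∃ g : lp (fun _ : V => ℂ) p', ‖g‖ ≤ ‖φ‖ ∧ ∀ y, g y = φ (lp.single p y 1) := by
    -- For `p = 1` the supremum bound comes from the unit vectors alone; otherwise both exponents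
    -- are finite and the extremal vector is used.
    by_cases hp' : p' = ⊤
    · subst hp'
      have hb : ∀ y, ‖φ (lp.single p y 1)‖ ≤ ‖φ‖ := fun y => by
        refine (φ.le_opNorm _).trans ?_
        rw [lp.norm_single hp0, norm_one, mul_one]
      refine ⟨⟨fun y => φ (lp.single p y 1), memℓp_infty ⟨‖φ‖, ?_⟩⟩, ?_, fun y => rfl⟩
      · rintro _ ⟨y, rfl⟩
        exact hb y
      · exact lp.norm_le_of_forall_le (norm_nonneg _) hb
    · have hP : p.toReal.HolderConjugate p'.toReal :=
        (ENNReal.HolderConjugate.toReal_of_ne_top hp' hp).symm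
      have hb := sum_rpow_dual_le hP rfl φ
      refine ⟨⟨fun y => φ (lp.single p y 1), memℓp_gen' hb⟩, ?_, fun y => rfl⟩
      exact lp.norm_le_of_forall_sum_le hP.symm.pos (norm_nonneg _) hb
  obtain ⟨g, hgn, hgy⟩ := hg
  refine ⟨g, hgn, ContinuousLinearMap.ext fun u => ?_⟩
  -- As `p < ∞`, `u` is the norm limit of its truncations, so the values on unit vectors determine
  -- `φ`.
  rw [lpPairing_apply, ← ((lp.hasSum_single hp u).mapL φ).tsum_eq]
  refine tsum_congr fun y => ?_
  rw [hgy, mul_comm, ← smul_eq_mul, ← map_smul, ← lp.single_smul, smul_eq_mul, mul_one]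

/-- Write `|a_y|² = |a_y|^p |a_y|^(2-p)` and bound the last factor by `‖a‖^(2-p)`. -/
theorem norm_two_le_norm (hp : p ≤ 2) (a : lp (fun _ : V => ℂ) p) :
    ‖(⟨a, (lp.memℓp a).of_exponent_ge hp⟩ : lp (fun _ : V => ℂ) 2)‖ ≤ ‖a‖ := by
  have hp1 : 1 ≤ p := Fact.out
  have hpt : p ≠ ⊤ := ne_top_of_le_ne_top (by simp) hp
  have hP0 : 0 < p.toReal := ENNReal.toReal_pos (zero_lt_one.trans_le hp1).ne' hpt
  have hP2 : p.toReal ≤ 2 := by simpa using ENNReal.toReal_mono (by simp) hp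
  refine lp.norm_le_of_forall_sum_le (by norm_num) (norm_nonneg _) fun A => ?_
  have hsplit : ∀ t : ℝ, 0 ≤ t → t ^ (2 : ℝ≥0∞).toReal = t ^ p.toReal * t ^ (2 - p.toReal) := by
    intro t ht
    rw [← Real.rpow_add' ht (by norm_num)]
    norm_num
  rw [hsplit _ (norm_nonneg a)]
  calc ∑ y ∈ A, ‖a y‖ ^ (2 : ℝ≥0∞).toReal
      ≤ ∑ y ∈ A, ‖a y‖ ^ p.toReal * ‖a‖ ^ (2 - p.toReal) := by
        refine Finset.sum_le_sum fun y _ => ?_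
        rw [hsplit _ (norm_nonneg _)]
        refine mul_le_mul_of_nonneg_left ?_ (by positivity)
        exact Real.rpow_le_rpow (norm_nonneg _)
          (lp.norm_apply_le_norm (zero_lt_one.trans_le hp1).ne' a y) (by linarith)
    _ = (∑ y ∈ A, ‖a y‖ ^ p.toReal) * ‖a‖ ^ (2 - p.toReal) := by rw [Finset.sum_mul]
    _ ≤ _ := mul_le_mul_of_nonneg_right (lp.sum_rpow_le_norm_rpow hP0 a A) (by positivity)

theorem transformSummable_of_le_two {r : ℝ≥0∞} [Fact (1 ≤ r)] (hp : p ≤ 2)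
    {a : ℕ → lp (fun _ : V => ℂ) p} {b : ℕ → lp (fun _ : V => ℂ) r}
    (h : Summable fun k => ‖a k‖ * ‖b k‖) : TransformSummable a b := by
  have hr : r ≠ 0 := (zero_lt_one.trans_le (Fact.out : 1 ≤ r)).ne'
  refine ⟨fun k => (lp.memℓp (a k)).of_exponent_ge hp, fun x => ?_⟩
  refine h.of_nonneg_of_le (fun k => by positivity) fun k => ?_
  rw [mul_comm]
  refine mul_le_mul ?_ (lp.norm_apply_le_norm hr _ _) (norm_nonneg _) (norm_nonneg _)
  have := norm_two_le_norm hp (a k)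
  rwa [norm_lp_two] at this

end Duality

/-! ### Nuclear decompositions and the adjoint. -/

section Adjoint

variable {p r p' r' : ℝ≥0∞} [Fact (1 ≤ p)] [Fact (1 ≤ r)] [Fact (1 ≤ p')] [Fact (1 ≤ r')]
  {T : lp (fun _ : V => ℂ) p →L[ℂ] lp (fun _ : V => ℂ) r}

theorem exists_isNuclearDecomposition [p'.HolderConjugate p] (hp : p ≠ ⊤) (hT : IsNuclear T) :
    ∃ (g : ℕ → lp (fun _ : V => ℂ) p') (f : ℕ → lp (fun _ : V => ℂ) r),
      IsNuclearDecomposition T g f := by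
  obtain ⟨φ, f, hs, hT⟩ := hT
  choose g hg1 hg2 using fun k => exists_eq_lpPairing (p' := p') hp (φ k)
  refine ⟨g, f, ?_, fun u => ?_⟩
  · exact hs.of_nonneg_of_le (fun k => by positivity) fun k =>
      mul_le_mul_of_nonneg_right (hg1 k) (norm_nonneg _)
  · simpa only [hg2, lpPairing_apply] using hT u

theorem IsNuclearDecomposition.hasSum_kernel [DecidableEq V] {g : ℕ → lp (fun _ : V => ℂ) p'}
    {f : ℕ → lp (fun _ : V => ℂ) r} (h : IsNuclearDecomposition T g f) (x y : V) :
    HasSum (fun k => f k x * g k y) (T (lp.single p y 1) x) := by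
  have h1 : HasSum (fun k => ((∑' j, g k j * (lp.single p y (1 : ℂ) :
      lp (fun _ : V => ℂ) p) j) • f k : lp (fun _ : V => ℂ) r) x) (T (lp.single p y 1) x) :=
    (h.2 (lp.single p y 1)).mapL (lp.evalCLM ℂ (fun _ : V => ℂ) r x)
  have h2 : ∀ k, ∑' j, g k j * (lp.single p y (1 : ℂ) : lp (fun _ : V => ℂ) p) j = g k y := by
    intro k
    rw [tsum_eq_single y fun j hj => by rw [lp.single_apply_ne _ _ _ hj, mul_zero],
      lp.single_apply_self, mul_one]
  simp only [h2, lp.coeFn_smul, Pi.smul_apply, smul_eq_mul] at h1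
  simpa only [mul_comm] using h1

theorem conj_lpPairing_star [p'.HolderConjugate p] (g : lp (fun _ : V => ℂ) p')
    (u : lp (fun _ : V => ℂ) p) :
    starRingEnd ℂ (lpPairing (star g) u) = lpPairing g (star u) := by
  rw [lpPairing_apply, lpPairing_apply, Complex.conj_tsum]
  refine tsum_congr fun y => ?_
  simp [lp.star_apply]

theorem lpPairing_comm [p'.HolderConjugate p] [p.HolderConjugate p']
    (g : lp (fun _ : V => ℂ) p') (u : lp (fun _ : V => ℂ) p) :
    lpPairing g u = lpPairing u g := by
  simp only [lpPairing_apply, mul_comm]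

/-- The rank one operator `u ↦ ⟨g,u⟩ f` has adjoint `v ↦ ⟨conj f,v⟩ conj g`; the pairings are
continuous, so the series may be compared term by term. -/
theorem isAdjoint_of_hasSum [p'.HolderConjugate p] [p.HolderConjugate p'] [r'.HolderConjugate r]
    [r.HolderConjugate r'] {S : lp (fun _ : V => ℂ) r' →L[ℂ] lp (fun _ : V => ℂ) p'}
    {g : ℕ → lp (fun _ : V => ℂ) p'} {f : ℕ → lp (fun _ : V => ℂ) r}
    (hT : ∀ u, HasSum (fun k => lpPairing (g k) u • f k) (T u))
    (hS : ∀ v, HasSum (fun k => lpPairing (star (f k)) v • star (g k)) (S v)) :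
    IsAdjoint T S := by
  intro u v
  have h1 : ∑' x, T u x * starRingEnd ℂ (v x) = lpPairing (star v) (T u) := by
    rw [lpPairing_apply]
    exact tsum_congr fun x => mul_comm _ _
  have h2 : ∑' x, u x * starRingEnd ℂ (S v x) = lpPairing u (star (S v)) := rfl
  have h3 : HasSum (fun k => lpPairing (star v) (lpPairing (g k) u • f k))
      (lpPairing (star v) (T u)) := (lpPairing (star v)).hasSum (hT u)
  have h4 : HasSum (fun k => star (lpPairing (star (f k)) v • star (g k))) (star (S v)) :=
    (hS v).star
  have h5 : HasSum (fun k => lpPairing u (star (lpPairing (star (f k)) v • star (g k))))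
      (lpPairing u (star (S v))) := (lpPairing u).hasSum h4
  have h6 : ∀ k, lpPairing u (star (lpPairing (star (f k)) v • star (g k))) =
      lpPairing (star v) (lpPairing (g k) u • f k) := by
    intro k
    have h7 : star (lpPairing (star (f k)) v) = lpPairing (f k) (star v) :=
      conj_lpPairing_star (f k) v
    rw [star_smul, star_star, map_smul, map_smul, h7, lpPairing_comm (g k),
      lpPairing_comm (f k), smul_eq_mul, smul_eq_mul, mul_comm]
  rw [h1, h2]
  refine h3.unique ?_
  simpa only [h6] using h5

theorem hasSum_smulRight_apply {E F : Type*} [NormedAddCommGroup E] [NormedSpace ℂ E]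
    [NormedAddCommGroup F] [NormedSpace ℂ F] {φ : ℕ → StrongDual ℂ E} {y : ℕ → F}
    {S : E →L[ℂ] F} (h : HasSum (fun k => (φ k).smulRight (y k)) S) (v : E) :
    HasSum (fun k => φ k v • y k) (S v) := by
  have h1 := h.map (ContinuousLinearMap.apply ℂ F v) (ContinuousLinearMap.continuous _)
  simpa [Function.comp_def] using h1

theorem exists_isNuclear_hasSum {E F : Type*} [NormedAddCommGroup E] [NormedSpace ℂ E]
    [NormedAddCommGroup F] [NormedSpace ℂ F] [CompleteSpace F] {φ : ℕ → StrongDual ℂ E}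
    {y : ℕ → F} (h : Summable fun k => ‖φ k‖ * ‖y k‖) :
    ∃ S : E →L[ℂ] F, IsNuclear S ∧ ∀ v, HasSum (fun k => φ k v • y k) (S v) := by
  have hsum : Summable fun k => (φ k).smulRight (y k) := by
    refine Summable.of_norm ?_
    simpa only [ContinuousLinearMap.norm_smulRight_apply] using h
  obtain ⟨S, hS⟩ := hsum
  exact ⟨S, ⟨φ, y, h, hasSum_smulRight_apply hS⟩, hasSum_smulRight_apply hS⟩

theorem exists_isAdjoint [p'.HolderConjugate p] [p.HolderConjugate p'] [r'.HolderConjugate r]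
    [r.HolderConjugate r'] {g : ℕ → lp (fun _ : V => ℂ) p'} {f : ℕ → lp (fun _ : V => ℂ) r}
    (h : IsNuclearDecomposition T g f) :
    ∃ S : lp (fun _ : V => ℂ) r' →L[ℂ] lp (fun _ : V => ℂ) p', IsAdjoint T S ∧ IsNuclear S := by
  have hB : Summable fun k =>
      ‖(lpPairing (star (f k)) : StrongDual ℂ (lp (fun _ : V => ℂ) r'))‖ * ‖star (g k)‖ := by
    refine h.1.of_nonneg_of_le (fun k => mul_nonneg (norm_nonneg _) (norm_nonneg _)) fun k => ?_
    rw [norm_star, mul_comm]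
    exact mul_le_mul_of_nonneg_left ((norm_lpPairing_le _).trans_eq (norm_star _))
      (norm_nonneg _)
  obtain ⟨S, hSn, hS⟩ := exists_isNuclear_hasSum hB
  exact ⟨S, isAdjoint_of_hasSum h.2 hS, hSn⟩

/-- Unit vectors as test functions recover `S` from the entries of `T`. This gives uniqueness and
ties the kernel of `S` to that of `T`. -/
theorem IsAdjoint.conj_apply [DecidableEq V] {S : lp (fun _ : V => ℂ) r' →L[ℂ] lp (fun _ : V => ℂ) p'}
    (h : IsAdjoint T S) (v : lp (fun _ : V => ℂ) r') (x : V) :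
    starRingEnd ℂ (S v x) = ∑' y, T (lp.single p x 1) y * starRingEnd ℂ (v y) := by
  rw [h (lp.single p x 1) v, tsum_eq_single x fun j hj => by
    rw [lp.single_apply_ne _ _ _ hj, zero_mul], lp.single_apply_self, one_mul]

theorem IsAdjoint.unique {S S' : lp (fun _ : V => ℂ) r' →L[ℂ] lp (fun _ : V => ℂ) p'}
    (h : IsAdjoint T S) (h' : IsAdjoint T S') : S' = S := by
  ext v x
  classical
  refine (starRingEnd ℂ).injective ?_
  rw [h.conj_apply, h'.conj_apply]

end Adjoint

/-! ### Kernels and symbols. -/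

section Symbol

variable {G : SimpleGraph V} {o : V} {q : ℕ}

theorem transform_single [DecidableEq V] (p : ℝ≥0∞) (y : V) :
    transform G q o (lp.single p y (1 : ℂ) : lp (fun _ : V => ℂ) p) = wave G q o y := by
  have hsupp : Function.support (lp.single p y (1 : ℂ) : lp (fun _ : V => ℂ) p) ⊆ {y} := by
    intro j hj
    by_contra hne
    exact hj (lp.single_apply_ne _ _ _ hne)
  rw [transform, if_pos ((Set.finite_singleton y).subset hsupp)]
  ext z
  rw [finsum_eq_single _ y fun j hj => by rw [lp.single_apply_ne _ _ _ hj, zero_mul],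
    lp.single_apply_self, one_mul]

theorem finite_support_single [DecidableEq V] (p : ℝ≥0∞) (y : V) :
    (Function.support (lp.single p y (1 : ℂ) : lp (fun _ : V => ℂ) p)).Finite := by
  refine (Set.finite_singleton y).subset fun j hj => ?_
  by_contra hne
  exact hj (lp.single_apply_ne _ _ _ hne)

variable {p r p' r' : ℝ≥0∞} [Fact (1 ≤ p)] [Fact (1 ≤ r)] [Fact (1 ≤ p')]
  [Fact (1 ≤ r')]
  {T : lp (fun _ : V => ℂ) p →L[ℂ] lp (fun _ : V => ℂ) r}
  {σ : V → Boundary G o × ℝ → ℂ}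

theorem HasSymbol.single [DecidableEq V] (hTσ : HasSymbol G q o T σ) (x y : V) :
    Integrable (fun z => waveBar G q o x z * σ x z * wave G q o y z) (dualMeasure G q o) ∧
    T (lp.single p y 1) x =
      ∫ z, waveBar G q o x z * σ x z * wave G q o y z ∂(dualMeasure G q o) := by
  have h := hTσ (lp.single p y 1) (finite_support_single p y) x
  rwa [transform_single] at h

variable [G.LocallyFinite]

/-- Superpositions of conjugate transforms, as functions on the dual and as functionals on
finitely supported functions. -/
theorem exists_hasSum_superposition (hq : 2 ≤ q) (hG : G.IsTree)
    (hreg : G.IsRegularOfDegree (q + 1)) {a : ℕ → V → ℂ} {b : ℕ → ℂ}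
    (ha : ∀ k, Memℓp (a k) 2) (hab : Summable fun k => ‖b k‖ * Real.sqrt (∑' y, ‖a k y‖ ^ 2)) :
    ∃ Φ : Boundary G o × ℝ → ℂ,
      (∀ᵐ z ∂(dualMeasure G q o),
        HasSum (fun k => starRingEnd ℂ (transform G q o (a k) z) * b k) (Φ z)) ∧
      ∀ u : V → ℂ, (Function.support u).Finite →
        Integrable (fun z => Φ z * transform G q o u z) (dualMeasure G q o) ∧
        HasSum (fun k => b k * ∑' y, starRingEnd ℂ (a k y) * u y)
          (∫ z, Φ z * transform G q o u z ∂(dualMeasure G q o)) := by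
  obtain ⟨Φ, h1, h2⟩ := exists_hasSum_conj_transform (o := o) hq hG hreg
    (fun k => (⟨a k, ha k⟩ : lp (fun _ : V => ℂ) 2)) b (by simpa only [norm_lp_two] using hab)
  refine ⟨Φ, h1, fun u hu => ?_⟩
  have h3 := h2 ⟨u, memℓp_of_finite_support hu 2⟩
  refine ⟨h3.1, ?_⟩
  convert h3.2 using 3 with k
  rw [lp.inner_eq_tsum]
  refine tsum_congr fun y => ?_
  rw [RCLike.inner_apply, mul_comm]

/-- The density that appears in the kernel of a nuclear decomposition. -/
theorem exists_hasSum_kernel_density [DecidableEq V] (hq : 2 ≤ q) (hG : G.IsTree)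
    (hreg : G.IsRegularOfDegree (q + 1)) {g : ℕ → lp (fun _ : V => ℂ) p'}
    {f : ℕ → lp (fun _ : V => ℂ) r} (hgf : TransformSummable g f) (x : V) :
    ∃ Φ : Boundary G o × ℝ → ℂ,
      (∀ᵐ z ∂(dualMeasure G q o), HasSum (fun k =>
        f k x * starRingEnd ℂ (transform G q o (fun y => starRingEnd ℂ (g k y)) z)) (Φ z)) ∧
      ∀ y, Integrable (fun z => Φ z * wave G q o y z) (dualMeasure G q o) ∧
        HasSum (fun k => f k x * g k y)
          (∫ z, Φ z * wave G q o y z ∂(dualMeasure G q o)) := by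
  obtain ⟨Φ, h1, h2⟩ := exists_hasSum_superposition (o := o) hq hG hreg
    (a := fun k y => starRingEnd ℂ (g k y)) (b := fun k => f k x)
    (fun k => (hgf.1 k).star_mem) (by simpa only [RCLike.norm_conj] using hgf.2 x)
  refine ⟨Φ, by simpa only [mul_comm] using h1, fun y => ?_⟩
  have h3 := h2 (lp.single p' y (1 : ℂ) : lp (fun _ : V => ℂ) p') (finite_support_single p' y)
  rw [transform_single] at h3
  refine ⟨h3.1, ?_⟩
  convert h3.2 using 3 with k
  rw [tsum_eq_single y fun j hj => by rw [lp.single_apply_ne _ _ _ hj, mul_zero],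
    lp.single_apply_self, mul_one, Complex.conj_conj]

/-- A nuclear decomposition of the operator decomposes the symbol. -/
theorem IsNuclearDecomposition.isSymbolDecomposition (hq : 2 ≤ q) (hG : G.IsTree)
    (hreg : G.IsRegularOfDegree (q + 1)) (hTσ : HasSymbol G q o T σ)
    {g : ℕ → lp (fun _ : V => ℂ) p'} {f : ℕ → lp (fun _ : V => ℂ) r}
    (h : IsNuclearDecomposition T g f) (hgf : TransformSummable g f) :
    IsSymbolDecomposition G q o σ g f := by
  classical
  refine ⟨h.1, fun x => ?_⟩
  obtain ⟨Φ, h1, h2⟩ := exists_hasSum_kernel_density (o := o) hq hG hreg hgf x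
  have h0 : ∀ᵐ z ∂(dualMeasure G q o), waveBar G q o x z * σ x z - Φ z = 0 := by
    -- Integrability is read off at the root, whose wave is `1`; the integrals agree because both
    -- are the kernel entry at `(x, y)`.
    refine ae_eq_zero_of_integral_wave hq hG hreg ?_ fun y => ?_
    · have h3 := (hTσ.single x o).1
      have h4 := (h2 o).1
      simp only [wave_root q hG, mul_one] at h3 h4
      exact h3.sub h4
    · simp only [sub_mul]
      rw [integral_sub (hTσ.single x y).1 (h2 y).1, ← (hTσ.single x y).2,
        (h2 y).2.unique (h.hasSum_kernel x y), sub_eq_zero]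
  filter_upwards [h0, h1] with z h3 h4
  have h5 := h4.mul_left (waveBar G q o x z)⁻¹
  rwa [← sub_eq_zero.1 h3, inv_mul_cancel_left₀ (waveBar_ne_zero hq x z)] at h5

/-- Integrating (b) against the waves recovers the kernel. The adjoint symbol needs only this kernel
expansion, so it can start from (a) or from (b). -/
theorem IsSymbolDecomposition.hasSum_kernel [DecidableEq V] (hq : 2 ≤ q) (hG : G.IsTree)
    (hreg : G.IsRegularOfDegree (q + 1)) (hTσ : HasSymbol G q o T σ)
    {g : ℕ → lp (fun _ : V => ℂ) p'} {f : ℕ → lp (fun _ : V => ℂ) r}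
    (h : IsSymbolDecomposition G q o σ g f) (hgf : TransformSummable g f) (x y : V) :
    HasSum (fun k => f k x * g k y) (T (lp.single p y 1) x) := by
  obtain ⟨Φ, h1, h2⟩ := exists_hasSum_kernel_density (o := o) hq hG hreg hgf x
  rw [(hTσ.single x y).2]
  convert (h2 y).2 using 1
  refine integral_congr_ae ?_
  filter_upwards [h1, h.2 x] with z h3 h4
  have h5 := (h4.mul_left (waveBar G q o x z)).unique
    (by simpa only [mul_inv_cancel_left₀ (waveBar_ne_zero hq x z)] using h3)
  rw [h5]

/-- The symbol of the adjoint. -/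
theorem IsAdjoint.hasSymbol_adjointSymbol [DecidableEq V] (hq : 2 ≤ q) (hG : G.IsTree)
    (hreg : G.IsRegularOfDegree (q + 1))
    {S : lp (fun _ : V => ℂ) r' →L[ℂ] lp (fun _ : V => ℂ) p'} (hS : IsAdjoint T S)
    {g : ℕ → lp (fun _ : V => ℂ) p'} {f : ℕ → lp (fun _ : V => ℂ) r}
    (hker : ∀ x y, HasSum (fun k => f k x * g k y) (T (lp.single p y 1) x))
    (hfg : TransformSummable f g) :
    (∀ x, ∀ᵐ z ∂(dualMeasure G q o), Summable fun k =>
      starRingEnd ℂ (transform G q o (f k) z) * starRingEnd ℂ (g k x)) ∧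
    HasSymbol G q o S (adjointSymbol G q o g f) := by
  have key := fun x => exists_hasSum_superposition (o := o) hq hG hreg
    (a := fun k => (f k : V → ℂ)) (b := fun k => starRingEnd ℂ (g k x)) hfg.1
    (by simpa only [RCLike.norm_conj] using hfg.2 x)
  refine ⟨fun x => ?_, fun v hv x => ?_⟩
  · obtain ⟨Φ, h1, -⟩ := key x
    exact h1.mono fun z hz => hz.summable
  obtain ⟨Φ, h1, h2⟩ := key x
  obtain ⟨h3, h4⟩ := h2 v hv
  have he : (fun z => Φ z * transform G q o v z) =ᵐ[dualMeasure G q o]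
      fun z => waveBar G q o x z * adjointSymbol G q o g f x z * transform G q o v z := by
    filter_upwards [h1] with z hz
    rw [adjointSymbol, hz.tsum_eq, mul_inv_cancel_left₀ (waveBar_ne_zero hq x z)]
  refine ⟨h3.congr he, ?_⟩
  rw [← integral_congr_ae he]
  refine HasSum.unique ?_ h4
  have hfin : ∀ c : V → ℂ, ∑' y, c y * v y = ∑ y ∈ hv.toFinset, c y * v y := fun c =>
    tsum_eq_sum fun y hy => by
      rw [Set.Finite.mem_toFinset, Function.notMem_support] at hy
      rw [hy, mul_zero]
  have hSv : S v x = ∑ y ∈ hv.toFinset, starRingEnd ℂ (T (lp.single p x 1) y) * v y := by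
    rw [← hfin, ← Complex.conj_conj (S v x)]
    have h5 := hS.conj_apply v x
    rw [h5, Complex.conj_tsum]
    simp only [map_mul, Complex.conj_conj]
  rw [hSv]
  -- Only the finitely many `y` in the support of `v` occur, so pointwise convergence of the kernel
  -- series suffices to exchange the sums.
  have h6 : ∀ y ∈ hv.toFinset, HasSum
      (fun k => starRingEnd ℂ (f k y * g k x) * v y)
      (starRingEnd ℂ (T (lp.single p x 1) y) * v y) := fun y _ =>
    ((hker y x).map (starRingEnd ℂ).toAddMonoidHom Complex.continuous_conj).mul_right (v y)
  convert hasSum_sum h6 using 2 with k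
  rw [hfin fun y => starRingEnd ℂ (f k y), Finset.mul_sum]
  refine Finset.sum_congr rfl fun y _ => ?_
  rw [map_mul]
  ring

end Symbol

end HomTree

/-! ### The theorem. -/

theorem mainTheorem4 {V : Type*} (G : SimpleGraph V) [G.LocallyFinite] (q : ℕ) (hq : 2 ≤ q)
    (hG : G.IsTree) (hreg : G.IsRegularOfDegree (q + 1)) (o : V)
    (p₁ p₂ p₁' p₂' : ℝ≥0∞) [Fact (1 ≤ p₁)] [Fact (1 ≤ p₂)] [Fact (1 ≤ p₁')] [Fact (1 ≤ p₂')]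
    (hp₁ : p₁ ≠ ⊤) (hp₂ : p₂ ≠ ⊤) (hpp₁ : p₁.HolderConjugate p₁') (hpp₂ : p₂.HolderConjugate p₂')
    (σ : V → HomTree.Boundary G o × ℝ → ℂ) (hσ : ∀ x, Measurable (σ x))
    (T : lp (fun _ : V => ℂ) p₁ →L[ℂ] lp (fun _ : V => ℂ) p₂)
    (hTσ : HomTree.HasSymbol G q o T σ) (hT : HomTree.IsNuclear T) :
    ∃ S : lp (fun _ : V => ℂ) p₂' →L[ℂ] lp (fun _ : V => ℂ) p₁',
      HomTree.IsAdjoint T S ∧ (∀ S', HomTree.IsAdjoint T S' → S' = S) ∧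
      HomTree.IsNuclear S ∧
      (∃ (g : ℕ → lp (fun _ : V => ℂ) p₁') (f : ℕ → lp (fun _ : V => ℂ) p₂),
        HomTree.IsNuclearDecomposition T g f ∧
        (2 ≤ p₁ → HomTree.IsSymbolDecomposition G q o σ g f)) ∧
      ∀ (g : ℕ → lp (fun _ : V => ℂ) p₁') (f : ℕ → lp (fun _ : V => ℂ) p₂),
        (HomTree.IsNuclearDecomposition T g f ∨
          ((2 ≤ p₁ ∨ HomTree.TransformSummable g f) ∧
            HomTree.IsSymbolDecomposition G q o σ g f)) →
        (p₂ ≤ 2 ∨ HomTree.TransformSummable f g) →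
        (∀ x, ∀ᵐ z ∂(HomTree.dualMeasure G q o), Summable fun k =>
          starRingEnd ℂ (HomTree.transform G q o (f k) z) * starRingEnd ℂ (g k x)) ∧
        HomTree.HasSymbol G q o S (HomTree.adjointSymbol G q o g f) := by
  classical
  have h₁ := hpp₁.symm
  have h₂ := hpp₂.symm
  obtain ⟨g₀, f₀, h₀⟩ := HomTree.exists_isNuclearDecomposition (p' := p₁') hp₁ hT
  obtain ⟨S, hS, hSn⟩ := HomTree.exists_isAdjoint (r' := p₂') h₀
  have hts : ∀ {g : ℕ → lp (fun _ : V => ℂ) p₁'} {f : ℕ → lp (fun _ : V => ℂ) p₂},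
      (Summable fun k => ‖g k‖ * ‖f k‖) → 2 ≤ p₁ → HomTree.TransformSummable g f :=
    fun h hp => HomTree.transformSummable_of_le_two (HomTree.le_two_of_holderConjugate hp) h
  refine ⟨S, hS, fun S' hS' => hS.unique hS', hSn, ⟨g₀, f₀, h₀, fun hp =>
    h₀.isSymbolDecomposition hq hG hreg hTσ (hts h₀.1 hp)⟩, fun g f hgf hfg => ?_⟩
  have hsum : Summable fun k => ‖g k‖ * ‖f k‖ := by
    rcases hgf with h | h
    · exact h.1
    · exact h.2.1
  refine hS.hasSymbol_adjointSymbol hq hG hreg ?_ ?_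
  · rcases hgf with h | ⟨h, hd⟩
    · exact h.hasSum_kernel
    · exact hd.hasSum_kernel hq hG hreg hTσ (h.elim (hts hsum) id)
  · refine hfg.elim (fun hp => HomTree.transformSummable_of_le_two hp ?_) id
    simpa only [mul_comm] using hsum
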